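/- Let $a>0$, $B_0>0$ and $0<\alpha_+<\alpha_-\le 1$, and let $I=(-1,1)$. For $\alpha\in(0,1]$ let $H_\alpha(B_0)$ be the self-adjoint operator $$H_\alpha(B_0)=-\partial_s^2+B_0^2\bigl(\alpha s-a\sqrt{1-\alpha^2}\,u\bigr)^2-a^{-2}\partial_u^2$$ in $L^2(\mathbb R\times I,\mathrm ds\,\mathrm du)$ with the Dirichlet condition at $u=\pm1$, i.e. the operator associated with the closure of the quadratic form $$\varphi\mapsto\|\partial_s\varphi\|^2+a^{-2}\|\partial_u\varphi\|^2+B_0^2\bigl\|\bigl(\alpha s-a\sqrt{1-\alpha^2}\,u\bigr)\varphi\bigr\|^2,\qquad \varphi\in C_0^\infty(\mathbb R\times I).$$ The eigenvalues of $H_{\alpha_\pm}(B_0)$ can be arranged in an infinite ascending sequence $\sigma_1(\alpha_\pm,B_0)\le\sigma_2(\alpha_\pm,B_0)\le\dots$ in which every eigenvalue is repeated according to its multiplicity. Put $$g(\alpha,\varepsilon):=\sqrt{\alpha^2+\alpha\sqrt{1-\alpha^2}\,\varepsilon},\qquad \varepsilon_0:=\frac{\alpha_-^2-\alpha_+^2}{\alpha_+\sqrt{1-\alpha_+^2}+\alpha_-\sqrt{1-\alpha_-^2}}.$$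 Then $g(\alpha_-,-\varepsilon)>g(\alpha_+,\varepsilon)$ for all $0<\varepsilon<\varepsilon_0$. If, in addition, $$a<a_0(\varepsilon):=\frac1{\sqrt{B_0}}\sqrt{\frac{g(\alpha_-,-\varepsilon)-g(\alpha_+,\varepsilon)}{1-\alpha_+^2+\varepsilon^{-1}\bigl(\alpha_+\sqrt{1-\alpha_+^2}+\alpha_-\sqrt{1-\alpha_-^2}\bigr)}}$$ holds for some $\varepsilon\in(0,\varepsilon_0)$, then $\sigma_m(\alpha_+,B_0)<\sigma_m(\alpha_-,B_0)$ for every $m\in\mathbb N$. -/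

import Mathlib

open MeasureTheory
open scoped ContDiff InnerProductSpace

noncomputable section

namespace BentLayer

/-! ### Eigenvalues of unbounded operators -/

section Eigenvalues

variable {E : Type*} [AddCommGroup E] [Module ℂ E]

/-- The eigenspace `{ψ ∈ Dom T : T ψ = z ψ}` of an unbounded operator. -/
def eigenspace (T : E →ₗ.[ℂ] E) (z : ℂ) : Submodule ℂ E :=
  T.graph.comap (LinearMap.prod LinearMap.id (z • LinearMap.id))

/-- `σ 0 ≤ σ 1 ≤ …` is the list of all eigenvalues of `T`, arranged in ascending order, each one
repeated according to its (finite or infinite) multiplicity. -/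
structure IsEigenvalueEnumeration (T : E →ₗ.[ℂ] E) (σ : ℕ → ℝ) : Prop where
  monotone : Monotone σ
  multiplicity : ∀ z : ℂ,
    Set.encard {m : ℕ | (σ m : ℂ) = z} = Cardinal.toENat (Module.rank ℂ (eigenspace T z))

end Eigenvalues

/-! ### The Hilbert space and the test functions -/

/-- The strip `ℝ × I`, `I = (-1, 1)`, with points `(s, u)`. -/
def strip : Set (ℝ × ℝ) := Set.univ ×ˢ Set.Ioo (-1 : ℝ) 1

/-- `L²(ℝ × I, ds du)`. -/
abbrev L2Strip : Type := Lp ℂ 2 ((volume : Measure (ℝ × ℝ)).restrict strip)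

/-- `C₀^∞(ℝ × I)`. -/
structure IsTestFunction (φ : ℝ × ℝ → ℂ) : Prop where
  smooth : ContDiff ℝ ∞ φ
  compact : HasCompactSupport φ
  supp : tsupport φ ⊆ strip

/-- `∂φ/∂s`. -/
def dS (φ : ℝ × ℝ → ℂ) (p : ℝ × ℝ) : ℂ := fderiv ℝ φ p (1, 0)

/-- `∂φ/∂u`. -/
def dU (φ : ℝ × ℝ → ℂ) (p : ℝ × ℝ) : ℂ := fderiv ℝ φ p (0, 1)

/-- The function `(s, u) ↦ α s - a √(1 - α²) u`. -/
def tilt (α a : ℝ) (p : ℝ × ℝ) : ℝ := α * p.1 - a * √(1 - α ^ 2) * p.2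

lemma IsTestFunction.add {φ ψ : ℝ × ℝ → ℂ} (hφ : IsTestFunction φ) (hψ : IsTestFunction ψ) :
    IsTestFunction (φ + ψ) :=
  ⟨hφ.smooth.add hψ.smooth, hφ.compact.add hψ.compact,
    (tsupport_add φ ψ).trans (Set.union_subset hφ.supp hψ.supp)⟩

lemma IsTestFunction.zero : IsTestFunction (0 : ℝ × ℝ → ℂ) :=
  ⟨contDiff_const, HasCompactSupport.zero, by simp [tsupport]⟩

lemma IsTestFunction.smul {φ : ℝ × ℝ → ℂ} (c : ℂ) (hφ : IsTestFunction φ) :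
    IsTestFunction (c • φ) :=
  ⟨hφ.smooth.const_smul c, hφ.compact.smul_left (f := fun _ => c),
    (closure_mono (Function.support_const_smul_subset c φ)).trans hφ.supp⟩

lemma IsTestFunction.differentiable {φ : ℝ × ℝ → ℂ} (hφ : IsTestFunction φ) :
    Differentiable ℝ φ := hφ.smooth.differentiable (by simp)

/-! ### The quadratic form and the operator -/

/-- The quadruples `(φ, ∂ₛφ, ∂ᵤφ, (α s - a √(1 - α²) u) φ)`, `φ ∈ C₀^∞(ℝ × I)`, in `(L²)⁴`. -/
def coreGraph (α a : ℝ) : Submodule ℂ (L2Strip × L2Strip × L2Strip × L2Strip) where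
  carrier := {F | ∃ φ : ℝ × ℝ → ℂ, IsTestFunction φ ∧
    F.1 =ᵐ[volume.restrict strip] φ ∧
    F.2.1 =ᵐ[volume.restrict strip] dS φ ∧
    F.2.2.1 =ᵐ[volume.restrict strip] dU φ ∧
    F.2.2.2 =ᵐ[volume.restrict strip] fun p => (tilt α a p : ℂ) * φ p}
  add_mem' := by
    rintro ⟨F, Fs, Fu, Ft⟩ ⟨G, Gs, Gu, Gt⟩ ⟨φ, hφ, h1, h2, h3, h4⟩ ⟨ψ, hψ, k1, k2, k3, k4⟩
    refine ⟨φ + ψ, hφ.add hψ, ?_, ?_, ?_, ?_⟩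
    · filter_upwards [Lp.coeFn_add F G, h1, k1] with p e a b
      simp_all
    · filter_upwards [Lp.coeFn_add Fs Gs, h2, k2] with p e a b
      simp_all [dS, fderiv_add (hφ.differentiable p) (hψ.differentiable p)]
    · filter_upwards [Lp.coeFn_add Fu Gu, h3, k3] with p e a b
      simp_all [dU, fderiv_add (hφ.differentiable p) (hψ.differentiable p)]
    · filter_upwards [Lp.coeFn_add Ft Gt, h4, k4] with p e a b
      simp_all [mul_add]
  zero_mem' := by
    refine ⟨0, IsTestFunction.zero, ?_, ?_, ?_, ?_⟩
    all_goals
      filter_upwards [Lp.coeFn_zero ℂ 2 (volume.restrict strip)] with p e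
      simp_all [dS, dU]
  smul_mem' := by
    rintro c ⟨F, Fs, Fu, Ft⟩ ⟨φ, hφ, h1, h2, h3, h4⟩
    refine ⟨c • φ, hφ.smul c, ?_, ?_, ?_, ?_⟩
    · filter_upwards [Lp.coeFn_smul c F, h1] with p e a
      simp_all
    · filter_upwards [Lp.coeFn_smul c Fs, h2] with p e a
      simp_all [dS, fderiv_const_smul (hφ.differentiable p) c]
    · filter_upwards [Lp.coeFn_smul c Fu, h3] with p e a
      simp_all [dU, fderiv_const_smul (hφ.differentiable p) c]
    · filter_upwards [Lp.coeFn_smul c Ft, h4] with p e a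
      simp_all [mul_left_comm]

/-- The closure of `coreGraph`. Its elements are the quadruples
`(ψ, ∂ₛψ, ∂ᵤψ, (α s - a √(1 - α²) u) ψ)` where `ψ` runs through the form domain of `H_α`, i.e. the
completion of `C₀^∞(ℝ × I)` in the form norm (so `ψ` satisfies the Dirichlet condition). -/
def formGraph (α a : ℝ) : Submodule ℂ (L2Strip × L2Strip × L2Strip × L2Strip) :=
  (coreGraph α a).topologicalClosure

/-- The sesquilinear form
`⟨∂ₛφ, ∂ₛψ⟩ + a⁻² ⟨∂ᵤφ, ∂ᵤψ⟩ + B² ⟨(α s - a √(1 - α²) u) φ, (α s - a √(1 - α²) u) ψ⟩`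
in terms of the quadruples in `formGraph`. -/
def energy (B a : ℝ) (F G : L2Strip × L2Strip × L2Strip × L2Strip) : ℂ :=
  ⟪F.2.1, G.2.1⟫_ℂ + ((a ^ 2)⁻¹ : ℝ) * ⟪F.2.2.1, G.2.2.1⟫_ℂ + (B ^ 2 : ℝ) * ⟪F.2.2.2, G.2.2.2⟫_ℂ

/-- The graph of the self-adjoint operator associated with the closed form: `(ψ, f)` belongs to it
iff `ψ` lies in the form domain and `q(φ, ψ) = ⟨φ, f⟩` for all `φ` in the form domain. -/
def operatorGraph (α B a : ℝ) : Submodule ℂ (L2Strip × L2Strip) where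
  carrier := {w | ∃ G ∈ formGraph α a, G.1 = w.1 ∧
    ∀ F ∈ formGraph α a, energy B a F G = ⟪F.1, w.2⟫_ℂ}
  add_mem' := by
    rintro ⟨x, f⟩ ⟨y, g⟩ ⟨G, hG, rfl, h⟩ ⟨G', hG', rfl, h'⟩
    refine ⟨G + G', add_mem hG hG', rfl, fun F hF => ?_⟩
    have e1 := h F hF
    have e2 := h' F hF
    simp only [energy, Prod.fst_add, Prod.snd_add, inner_add_right] at *
    rw [← e1, ← e2]; ring
  zero_mem' := ⟨0, zero_mem _, rfl, fun F _ => by simp [energy]⟩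
  smul_mem' := by
    rintro c ⟨x, f⟩ ⟨G, hG, rfl, h⟩
    refine ⟨c • G, Submodule.smul_mem _ c hG, rfl, fun F hF => ?_⟩
    have e1 := h F hF
    simp only [energy, Prod.smul_fst, Prod.smul_snd, inner_smul_right] at *
    rw [← e1]; ring

/-- The operator `H_α(B) = -∂ₛ² + B² (α s - a √(1 - α²) u)² - a⁻² ∂ᵤ²` in `L²(ℝ × I)` with the
Dirichlet condition at `u = ±1`, defined in the form sense. -/
def modelOperator (α B a : ℝ) : L2Strip →ₗ.[ℂ] L2Strip := (operatorGraph α B a).toLinearPMap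

/-! ### The operator is well defined -/

lemma IsTestFunction.memLp {φ : ℝ × ℝ → ℂ} (hφ : IsTestFunction φ) :
    MemLp φ 2 (volume.restrict strip) :=
  (hφ.smooth.continuous.memLp_of_hasCompactSupport hφ.compact).restrict strip

lemma IsTestFunction.fderiv_apply {φ : ℝ × ℝ → ℂ} (hφ : IsTestFunction φ) (v : ℝ × ℝ) :
    IsTestFunction (fun p => fderiv ℝ φ p v) := by
  refine ⟨(hφ.smooth.fderiv_right (m := ∞) (by simp)).clm_apply contDiff_const, ?_, ?_⟩
  · exact hφ.compact.fderiv_apply ℝ v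
  · exact (tsupport_fderiv_apply_subset ℝ v).trans hφ.supp

lemma IsTestFunction.tilt_mul {φ : ℝ × ℝ → ℂ} (hφ : IsTestFunction φ) (α a : ℝ) :
    IsTestFunction (fun p => (tilt α a p : ℂ) * φ p) := by
  have h : ContDiff ℝ ∞ (fun p => (tilt α a p : ℂ)) := by
    have h' : ContDiff ℝ ∞ (tilt α a) := by
      unfold tilt
      fun_prop
    exact Complex.ofRealCLM.contDiff.comp h'
  refine ⟨h.mul hφ.smooth, hφ.compact.mul_left, ?_⟩
  exact (closure_mono (Function.support_mul_subset_right _ _)).trans hφ.supp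

/-- The quadruple in `coreGraph` that belongs to a test function. -/
def IsTestFunction.quad {φ : ℝ × ℝ → ℂ} (hφ : IsTestFunction φ) (α a : ℝ) :
    L2Strip × L2Strip × L2Strip × L2Strip :=
  (hφ.memLp.toLp φ, (hφ.fderiv_apply (1, 0)).memLp.toLp _, (hφ.fderiv_apply (0, 1)).memLp.toLp _,
    (hφ.tilt_mul α a).memLp.toLp _)

lemma IsTestFunction.quad_mem {φ : ℝ × ℝ → ℂ} (hφ : IsTestFunction φ) (α a : ℝ) :
    hφ.quad α a ∈ coreGraph α a :=
  ⟨φ, hφ, hφ.memLp.coeFn_toLp, (hφ.fderiv_apply (1, 0)).memLp.coeFn_toLp,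
    (hφ.fderiv_apply (0, 1)).memLp.coeFn_toLp, (hφ.tilt_mul α a).memLp.coeFn_toLp⟩

lemma inner_toLp {φ : ℝ × ℝ → ℂ} (hφ : IsTestFunction φ) {F : L2Strip} {ψ : ℝ × ℝ → ℂ}
    (hF : F =ᵐ[volume.restrict strip] ψ) (hψ : IsTestFunction ψ) :
    ⟪hφ.memLp.toLp φ, F⟫_ℂ = ∫ p, (starRingEnd ℂ) (φ p) * ψ p := by
  rw [MeasureTheory.L2.inner_def]
  have h : ∫ p in strip, ⟪(hφ.memLp.toLp φ : ℝ × ℝ → ℂ) p, F p⟫_ℂ =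
      ∫ p in strip, (starRingEnd ℂ) (φ p) * ψ p := by
    refine integral_congr_ae ?_
    filter_upwards [hφ.memLp.coeFn_toLp, hF] with p e1 e2
    rw [e1, e2, RCLike.inner_apply, mul_comm]
  rw [h]
  refine setIntegral_eq_integral_of_forall_compl_eq_zero fun p hp => ?_
  rw [image_eq_zero_of_notMem_tsupport fun hm => hp (hψ.supp hm), mul_zero]

lemma inner_fderiv {φ ψ : ℝ × ℝ → ℂ} (hφ : IsTestFunction φ) (hψ : IsTestFunction ψ)
    (v : ℝ × ℝ) {F F' : L2Strip} (hF : F =ᵐ[volume.restrict strip] ψ)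
    (hF' : F' =ᵐ[volume.restrict strip] fun p => fderiv ℝ ψ p v) :
    ⟪(hφ.fderiv_apply v).memLp.toLp _, F'⟫_ℂ +
      ⟪((hφ.fderiv_apply v).fderiv_apply v).memLp.toLp _, F⟫_ℂ = 0 := by
  rw [inner_toLp (hφ.fderiv_apply v) hF' (hψ.fderiv_apply v),
    inner_toLp ((hφ.fderiv_apply v).fderiv_apply v) hF hψ]
  set χ : ℝ × ℝ → ℂ := fun p => fderiv ℝ φ p v with hχ
  have tχ : IsTestFunction χ := hφ.fderiv_apply v
  set η : ℝ × ℝ → ℂ := fun p => (starRingEnd ℂ) (χ p) with hη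
  have sη : ContDiff ℝ ∞ η := Complex.conjCLE.contDiff.comp tχ.smooth
  have dη : ∀ p, fderiv ℝ η p v = (starRingEnd ℂ) (fderiv ℝ χ p v) := fun p => by
    have := (Complex.conjCLE.toContinuousLinearMap.hasFDerivAt (x := χ p)).comp p
      (tχ.differentiable p).hasFDerivAt
    have h2 : HasFDerivAt η _ p := this
    rw [h2.fderiv]; simp
  have key := integral_mul_fderiv_eq_neg_fderiv_mul_of_integrable (μ := (volume : Measure (ℝ × ℝ)))
    (f := η) (g := ψ) (v := v)
    (Continuous.integrable_of_hasCompactSupport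
      (((sη.fderiv_right (m := ∞) (by simp)).clm_apply contDiff_const).continuous.mul
        hψ.smooth.continuous) hψ.compact.mul_left)
    (Continuous.integrable_of_hasCompactSupport
      (sη.continuous.mul (hψ.fderiv_apply v).smooth.continuous)
      (hψ.fderiv_apply v).compact.mul_left)
    (Continuous.integrable_of_hasCompactSupport
      (sη.continuous.mul hψ.smooth.continuous) hψ.compact.mul_left)
    (fun x _ => sη.differentiable (by simp) x) (fun x _ => hψ.differentiable x)
  simp only [dη] at key
  rw [show (∫ p, (starRingEnd ℂ) (χ p) * fderiv ℝ ψ p v) = _ from key]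
  simp

/-- The form pairing with a test function, expressed through the first entry alone. -/
lemma energy_test {φ : ℝ × ℝ → ℂ} (hφ : IsTestFunction φ) (α B a : ℝ)
    {G : L2Strip × L2Strip × L2Strip × L2Strip} (hG : G ∈ formGraph α a) (h0 : G.1 = 0) :
    energy B a (hφ.quad α a) G = 0 := by
  let P : L2Strip × L2Strip × L2Strip × L2Strip → Prop := fun G =>
      (⟪(hφ.quad α a).2.1, G.2.1⟫_ℂ +
        ⟪((hφ.fderiv_apply (1, 0)).fderiv_apply (1, 0)).memLp.toLp _, G.1⟫_ℂ = 0) ∧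
      (⟪(hφ.quad α a).2.2.1, G.2.2.1⟫_ℂ +
        ⟪((hφ.fderiv_apply (0, 1)).fderiv_apply (0, 1)).memLp.toLp _, G.1⟫_ℂ = 0) ∧
      (⟪(hφ.quad α a).2.2.2, G.2.2.2⟫_ℂ -
        ⟪((hφ.tilt_mul α a).tilt_mul α a).memLp.toLp _, G.1⟫_ℂ = 0)
  have main : ∀ G ∈ formGraph α a, P G := by
    intro G hG
    refine closure_minimal
      (s := (coreGraph α a : Set (L2Strip × L2Strip × L2Strip × L2Strip)))
      (t := {G | P G}) ?_ ?_ hG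
    · rintro ⟨K, Ks, Ku, Kt⟩ ⟨ψ, hψ, k1, k2, k3, k4⟩
      refine ⟨inner_fderiv hφ hψ (1, 0) k1 k2, inner_fderiv hφ hψ (0, 1) k1 k3, ?_⟩
      simp only [IsTestFunction.quad]
      rw [inner_toLp (hφ.tilt_mul α a) k4 (hψ.tilt_mul α a),
        inner_toLp ((hφ.tilt_mul α a).tilt_mul α a) k1 hψ, sub_eq_zero]
      refine integral_congr_ae (Filter.Eventually.of_forall fun p => ?_)
      simp; ring
    · refine IsClosed.and ?_ (IsClosed.and ?_ ?_)
      all_goals exact isClosed_eq (by fun_prop) continuous_const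
  obtain ⟨h1, h2, h3⟩ := main G hG
  simp only [h0, inner_zero_right, add_zero, sub_zero] at h1 h2 h3
  simp [energy, h1, h2, h3]

lemma isOpen_strip : IsOpen strip := isOpen_univ.prod isOpen_Ioo

lemma operatorGraph_functional (α B a : ℝ) :
    ∀ w ∈ operatorGraph α B a, w.1 = 0 → w.2 = 0 := by
  rintro ⟨x, f⟩ ⟨G, hG, hx, h⟩ (rfl : x = 0)
  have hf : ∀ φ : ℝ × ℝ → ℂ, ∀ hφ : IsTestFunction φ, ⟪hφ.memLp.toLp φ, f⟫_ℂ = 0 := by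
    intro φ hφ
    have e := h (hφ.quad α a) ((coreGraph α a).le_topologicalClosure (hφ.quad_mem α a))
    rw [energy_test hφ α B a hG hx] at e
    exact e.symm
  have hae : ∀ᵐ p ∂(volume : Measure (ℝ × ℝ)), p ∈ strip → f p = 0 := by
    refine isOpen_strip.ae_eq_zero_of_integral_contDiff_smul_eq_zero ?_ ?_
    · have : LocallyIntegrable f (volume.restrict strip) :=
        (Lp.memLp f).locallyIntegrable (by norm_num)
      exact locallyIntegrableOn_of_locallyIntegrable_restrict this
    · intro η hη cη sη
      have tη : IsTestFunction (fun p => (η p : ℂ)) :=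
        ⟨Complex.ofRealCLM.contDiff.comp hη, cη.comp_left (g := Complex.ofReal) rfl,
          (closure_mono (Function.support_comp_subset (g := Complex.ofReal) rfl η)).trans sη⟩
      have e := hf _ tη
      rw [MeasureTheory.L2.inner_def] at e
      rw [← setIntegral_eq_integral_of_forall_compl_eq_zero (s := strip), ← e]
      · refine integral_congr_ae ?_
        filter_upwards [tη.memLp.coeFn_toLp] with p e1
        rw [e1, RCLike.inner_apply]
        simp [mul_comm]
      · intro p hp
        rw [image_eq_zero_of_notMem_tsupport fun hm => hp (sη hm), zero_smul]
  refine Lp.ext ?_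
  have hs : MeasurableSet strip := isOpen_strip.measurableSet
  filter_upwards [(ae_restrict_iff' hs).2 hae, Lp.coeFn_zero ℂ 2 (volume.restrict strip)]
    with p e1 e2
  rw [e1, e2]; rfl

/-- `modelOperator` is the operator with graph `operatorGraph`. -/
lemma modelOperator_graph (α B a : ℝ) : (modelOperator α B a).graph = operatorGraph α B a :=
  Submodule.toLinearPMap_graph_eq _ fun w hw h => operatorGraph_functional α B a w hw h

/-! ### The explicit constants -/

/-- `g(α, ε) = √(α² + α √(1 - α²) ε)`. -/
def g (α ε : ℝ) : ℝ := √(α ^ 2 + α * √(1 - α ^ 2) * ε)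

/-- `ε₀`, for the asymptotic slopes `αm = α₋` and `αp = α₊`. -/
def eps0 (αm αp : ℝ) : ℝ :=
  (αm ^ 2 - αp ^ 2) / (αp * √(1 - αp ^ 2) + αm * √(1 - αm ^ 2))

/-- `a₀(ε)`, for the asymptotic slopes `αm = α₋` and `αp = α₊` and the field `B`. -/
def a0 (αm αp B ε : ℝ) : ℝ :=
  1 / √B * √((g αm (-ε) - g αp ε) /
    (1 - αp ^ 2 + ε⁻¹ * (αp * √(1 - αp ^ 2) + αm * √(1 - αm ^ 2))))

end BentLayer

end

/-! The operators are compared through their quadratic forms after a dilation in `s`. Write β = √(1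
- α²). Since |u| < 1, Young's inequality with parameter ε bounds the cross term 2aαβsu by αβ(εs² +
a²/ε). Hence tilt₊² lies below g₊²s² and tilt₋² above g₋²s², up to constants of order a², where g₊ =
`g αp ε` and g₋ = `g αm (-ε)` (`tilt_sq_le`, `le_tilt_sq`).

The oscillators -∂ₛ² + B²g²s² are dilations of one another up to the factor g. If κ² = g₊/g₋ and φ =
√κ ψ(κs, u), the oscillator part of φ for g₊ is κ² times that of ψ for g₋. The remaining share 1 -
κ² is at least (1 - κ²)Bg₋‖ψ‖² = B(g₋ - g₊)‖ψ‖² by the ground state bound `oscillator_le`. The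
transverse energy does not change. So q₊(φ) + δ‖ψ‖² ≤ q₋(ψ) with ‖φ‖ = ‖ψ‖ and δ = `spectralGap`
(`quadForm_dilate_add_le`), and a < a₀(ε) makes δ positive (`spectralGap_pos`). Min-max then gives
σₘ(α₊) + δ ≤ σₘ(α₋) for all m.

For min-max, let J be the embedding of the form domain, with norm² q + ‖·‖², into L². Then (H + 1)⁻¹
= JJ* (`isFormOperator_modelOperator`), and J is compact: the mean values over finitely many small
squares control a function on a bounded piece of the strip by Poincaré, and tilt² is large on the
rest (`isCompactOperator_embed`). The spectral theory of JJ* turns any eigenvalue enumeration into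
an orthonormal system of eigenvectors, and a dimension count compares two of them
(`eigenvalue_add_le`). Since the dilation is known only on test functions, the comparison runs along
the closure of its graph, a linear relation between the two form domains. -/

noncomputable section

namespace BentLayer

/-! ### Compactness criterion -/

section Abstract

variable {V H : Type*} [NormedAddCommGroup V] [InnerProductSpace ℂ V] [CompleteSpace V]
  [NormedAddCommGroup H] [InnerProductSpace ℂ H] [CompleteSpace H]

/-- An operator is compact if, up to finitely many functionals, its norm is arbitrarily small. -/
theorem isCompactOperator_of_forall_norm_sq_le (J : V →L[ℂ] H)
    (h : ∀ η : ℝ, 0 < η → ∃ (n : ℕ) (f : Fin n → H) (C : ℝ), ∀ x : V,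
      ‖J x‖ ^ 2 ≤ η * ‖x‖ ^ 2 + C * ∑ i, ‖⟪f i, J x⟫_ℂ‖ ^ 2) :
    IsCompactOperator J := by
  refine isClosed_setOfPred_isCompactOperator.closure_subset_iff.2 subset_rfl
    (Metric.mem_closure_iff.2 fun ε hε => ?_ : J ∈ closure {f : V →L[ℂ] H | IsCompactOperator f})
  obtain ⟨n, f, C, hf⟩ := h ((ε / 2) ^ 2) (by positivity)
  -- On the common kernel W of the functionals the hypothesis reads ‖Jx‖ ≤ (ε/2)‖x‖, and Wᗮ is
  -- finite-dimensional because F is injective there. So J composed with the projection onto Wᗮ is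
  -- compact and differs from J by J composed with the projection onto W.
  let F : V →L[ℂ] (Fin n → ℂ) := ContinuousLinearMap.pi fun i => (innerSL ℂ (f i)).comp J
  let W : Submodule ℂ V := F.ker
  have hWc : IsClosed (W : Set V) := F.isClosed_ker
  have : CompleteSpace W := hWc.completeSpace_coe
  have hfin : FiniteDimensional ℂ Wᗮ := by
    refine FiniteDimensional.of_injective (F.toLinearMap.comp Wᗮ.subtype) ?_
    rw [← LinearMap.ker_eq_bot, LinearMap.ker_eq_bot']
    rintro ⟨x, hx⟩ h0
    have hxW : x ∈ W := h0
    have : ⟪x, x⟫_ℂ = 0 := hx x hxW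
    exact Subtype.ext (inner_self_eq_zero.1 this)
  refine ⟨(J.comp Wᗮ.subtypeL).comp Wᗮ.orthogonalProjectionOnto, ?_, ?_⟩
  · have : IsCompactOperator (J.comp Wᗮ.subtypeL) := by
      have : ProperSpace Wᗮ := FiniteDimensional.proper ℂ _
      exact isCompactOperator_of_locallyCompactSpace_rng (J.comp Wᗮ.subtypeL)
    exact this.comp_clm _
  · rw [dist_eq_norm]
    refine (ContinuousLinearMap.opNorm_le_bound _ (by positivity : 0 ≤ ε / 2) fun x => ?_).trans_lt
      (by linarith)
    have e : (J - (J.comp Wᗮ.subtypeL).comp Wᗮ.orthogonalProjectionOnto) x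
        = J (W.orthogonalProjectionOnto x) := by
      have := W.starProjection_add_starProjection_orthogonal x
      simp only [Submodule.starProjection_apply] at this
      rw [_root_.sub_apply, sub_eq_iff_eq_add]
      conv_lhs => rw [← this, map_add]
      rfl
    rw [e]
    have h1 := hf (W.orthogonalProjectionOnto x)
    have h2 : ∀ i, ⟪f i, J (W.orthogonalProjectionOnto x)⟫_ℂ = 0 := fun i => by
      have : F (W.orthogonalProjectionOnto x) = 0 := (W.orthogonalProjectionOnto x).2
      exact congrFun this i
    simp only [h2, norm_zero, ne_eq, OfNat.ofNat_ne_zero, not_false_eq_true, zero_pow,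
      Finset.sum_const_zero, mul_zero, add_zero] at h1
    have h3 : ‖(W.orthogonalProjectionOnto x : V)‖ ≤ ‖x‖ :=
      W.norm_orthogonalProjectionOnto_apply_le x
    refine abs_le_of_sq_le_sq' ?_ (by positivity) |>.2
    rw [mul_pow]
    refine h1.trans ?_
    gcongr

/-! ### Operators with compact resolvent -/

/-- The operator `J J*`. -/
def gram (J : V →L[ℂ] H) : H →L[ℂ] H := J.comp (ContinuousLinearMap.adjoint J)

lemma inner_gram (J : V →L[ℂ] H) (x y : H) :
    ⟪x, gram J y⟫_ℂ = ⟪ContinuousLinearMap.adjoint J x, ContinuousLinearMap.adjoint J y⟫_ℂ := by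
  rw [gram, ContinuousLinearMap.comp_apply, ContinuousLinearMap.adjoint_inner_left]

lemma gram_isSymmetric (J : V →L[ℂ] H) : (gram J : H →ₗ[ℂ] H).IsSymmetric := by
  intro x y
  have := inner_gram J x y
  have h2 := inner_gram J y x
  rw [← inner_conj_symm, ContinuousLinearMap.coe_coe, h2, inner_conj_symm, ← this]

lemma gram_isCompactOperator {J : V →L[ℂ] H} (hJ : IsCompactOperator J) :
    IsCompactOperator (gram J) := hJ.comp_clm _

/-- A bound for `J*` on the orthogonal complement of the eigenvectors of `J J*` with large
eigenvalues. -/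
theorem norm_adjoint_sq_le {J : V →L[ℂ] H} (hJ : IsCompactOperator J) {μ : ℝ} (hμ : 0 ≤ μ) (x : H)
    (hx : ∀ ν : ℝ, μ < ν → ∀ y : H, gram J y = (ν : ℂ) • y → ⟪y, x⟫_ℂ = 0) :
    ‖ContinuousLinearMap.adjoint J x‖ ^ 2 ≤ μ * ‖x‖ ^ 2 := by
  set K := gram J with hK
  have hs : (K : H →ₗ[ℂ] H).IsSymmetric := gram_isSymmetric J
  -- W is closed and, by symmetry, invariant under K. It contains no eigenvector with eigenvalue
  -- above μ, since such a vector would be orthogonal to itself.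
  let W : Submodule ℂ H :=
    { carrier := {x | ∀ ν : ℝ, μ < ν → ∀ y : H, K y = (ν : ℂ) • y → ⟪y, x⟫_ℂ = 0}
      add_mem' := fun {a b} ha hb ν hν y hy => by
        rw [inner_add_right, ha ν hν y hy, hb ν hν y hy, add_zero]
      zero_mem' := fun ν hν y hy => inner_zero_right _
      smul_mem' := fun c a ha ν hν y hy => by rw [inner_smul_right, ha ν hν y hy, mul_zero] }
  have hWc : IsClosed (W : Set H) := by
    have : (W : Set H) = ⋂ (ν : ℝ) (_ : μ < ν) (y : H) (_ : K y = (ν : ℂ) • y),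
        {x | ⟪y, x⟫_ℂ = 0} := by
      ext x
      simp only [Set.mem_iInter]
      rfl
    rw [this]
    exact isClosed_iInter fun _ => isClosed_iInter fun _ => isClosed_iInter fun _ =>
      isClosed_iInter fun _ => isClosed_eq (by fun_prop) continuous_const
  have : CompleteSpace W := hWc.completeSpace_coe
  have hinv : ∀ v ∈ W, (K : H →ₗ[ℂ] H) v ∈ W := fun v hv ν hν y hy => by
    rw [← hs y v, ContinuousLinearMap.coe_coe, hy, inner_smul_left, hv ν hν y hy, mul_zero]
  let S : W →L[ℂ] W := K.restrict hinv
  have hSc : IsCompactOperator S := (gram_isCompactOperator hJ).restrict' hinv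
  have hSs : (S : W →ₗ[ℂ] W).IsSymmetric := hs.restrict_invariant hinv
  -- For self-adjoint S the norm is the spectral radius; as S is compact, its nonzero spectral
  -- values are eigenvalues. They are real, nonnegative because ⟨v, Kv⟩ = ‖J*v‖², and at most μ by
  -- the choice of W.
  have hnorm : ‖S‖₊ ≤ μ.toNNReal := by
    rw [← ENNReal.coe_le_coe, ← S.spectralRadius_eq_nnnorm hSs.isSelfAdjoint, spectralRadius]
    refine iSup₂_le fun k hk => ?_
    rw [ENNReal.coe_le_coe, ← NNReal.coe_le_coe, coe_nnnorm, Real.coe_toNNReal _ hμ]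
    by_cases k0 : k = 0
    · simpa [k0] using hμ
    have hev := (hSc.hasEigenvalue_iff_mem_spectrum k0).2 hk
    have hconj := hSs.conj_eigenvalue_eq_self hev
    obtain ⟨v, hv⟩ := hev.exists_hasEigenvector
    have hv1 : K (v : H) = k • (v : H) := congrArg Subtype.val hv.apply_eq_smul
    obtain ⟨r, rfl⟩ := Complex.conj_eq_iff_real.1 hconj
    have hv0 : (v : H) ≠ 0 := fun h => hv.2 (Subtype.ext h)
    have hin : ⟪(v : H), K v⟫_ℂ = r * (‖(v : H)‖ : ℂ) ^ 2 := by
      rw [hv1, inner_smul_right, inner_self_eq_norm_sq_to_K]; rfl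
    rw [hK, inner_gram, inner_self_eq_norm_sq_to_K] at hin
    have hin' : ‖ContinuousLinearMap.adjoint J (v : H)‖ ^ 2 = r * ‖(v : H)‖ ^ 2 := by
      have h := congrArg Complex.re hin
      norm_cast at h
    have hr : 0 ≤ r := by
      have : 0 < ‖(v : H)‖ ^ 2 := by positivity
      by_contra! hneg
      nlinarith [sq_nonneg ‖ContinuousLinearMap.adjoint J (v : H)‖]
    rw [Complex.norm_real, Real.norm_of_nonneg hr]
    by_contra! hlt
    exact hv0 (inner_self_eq_zero.1 (v.2 r hlt v hv1))
  have hxS : ‖K x‖ ≤ μ * ‖x‖ := by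
    have h1 := S.le_opNorm ⟨x, hx⟩
    have h2 : ‖S‖ ≤ μ := by
      have := NNReal.coe_le_coe.2 hnorm
      rwa [Real.coe_toNNReal _ hμ] at this
    refine (show ‖K x‖ = ‖S ⟨x, hx⟩‖ from rfl).le.trans (h1.trans ?_)
    exact mul_le_mul_of_nonneg_right h2 (norm_nonneg x)
  have h3 : (‖ContinuousLinearMap.adjoint J x‖ : ℂ) ^ 2 = ⟪x, K x⟫_ℂ := by
    rw [hK, inner_gram, inner_self_eq_norm_sq_to_K]; rfl
  have h4 : ‖ContinuousLinearMap.adjoint J x‖ ^ 2 = ‖⟪x, K x⟫_ℂ‖ := by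
    rw [← h3]; simp
  rw [h4]
  calc ‖⟪x, K x⟫_ℂ‖ ≤ ‖x‖ * ‖K x‖ := norm_inner_le_norm _ _
    _ ≤ ‖x‖ * (μ * ‖x‖) := by gcongr
    _ = μ * ‖x‖ ^ 2 := by ring

/-- The form version of the preceding bound. -/
theorem norm_apply_sq_le {J : V →L[ℂ] H} (hJ : IsCompactOperator J) {μ : ℝ} (hμ : 0 ≤ μ) (φ : V)
    (hφ : ∀ ν : ℝ, μ < ν → ∀ y : H, gram J y = (ν : ℂ) • y → ⟪y, J φ⟫_ℂ = 0) :
    ‖J φ‖ ^ 2 ≤ μ * ‖φ‖ ^ 2 := by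
  have h1 := norm_adjoint_sq_le hJ hμ (J φ) hφ
  -- Cauchy–Schwarz for ‖Jφ‖² = ⟨φ, J*Jφ⟩. Squaring, inserting the bound for J* at Jφ and cancelling
  -- ‖Jφ‖² gives the claim.
  have h2 : ‖J φ‖ ^ 2 ≤ ‖φ‖ * ‖ContinuousLinearMap.adjoint J (J φ)‖ := by
    have h : (‖J φ‖ : ℂ) ^ 2 = ⟪φ, ContinuousLinearMap.adjoint J (J φ)⟫_ℂ := by
      rw [ContinuousLinearMap.adjoint_inner_right, inner_self_eq_norm_sq_to_K]; rfl
    have h' : ‖J φ‖ ^ 2 = ‖⟪φ, ContinuousLinearMap.adjoint J (J φ)⟫_ℂ‖ := by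
      rw [← h]; simp
    rw [h']
    exact norm_inner_le_norm _ _
  rcases (norm_nonneg (J φ)).eq_or_lt with h0 | h0
  · rw [← h0, zero_pow two_ne_zero]; positivity
  have h3 : (‖J φ‖ ^ 2) ^ 2 ≤ ‖φ‖ ^ 2 * (μ * ‖J φ‖ ^ 2) :=
    calc (‖J φ‖ ^ 2) ^ 2 ≤ (‖φ‖ * ‖ContinuousLinearMap.adjoint J (J φ)‖) ^ 2 := by gcongr
      _ = ‖φ‖ ^ 2 * ‖ContinuousLinearMap.adjoint J (J φ)‖ ^ 2 := by ring
      _ ≤ _ := by gcongr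
  have h4 : 0 < ‖J φ‖ ^ 2 := by positivity
  nlinarith

end Abstract

/-! ### Eigenvalues and eigenvectors of T expressed through JJ* -/

section CompactResolvent

variable {V H : Type*} [NormedAddCommGroup V] [InnerProductSpace ℂ V] [CompleteSpace V]
  [NormedAddCommGroup H] [InnerProductSpace ℂ H] [CompleteSpace H]

/-- `T` is the operator in `H` which belongs to the form `‖φ‖² - ‖J φ‖²` on `V`, that is
`(T + 1)⁻¹ = J J*`. -/
def IsFormOperator (J : V →L[ℂ] H) (T : H →ₗ.[ℂ] H) : Prop :=
  ∀ x f : H, (x, f) ∈ T.graph ↔ gram J (f + x) = x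

variable {J : V →L[ℂ] H} {T : H →ₗ.[ℂ] H}

/-- Tx = zx means (T + 1)x = (1 + z)x, and JJ* inverts T + 1. The equation makes sense for z = -1
too, where it forces x = 0. -/
lemma IsFormOperator.mem_eigenspace (hT : IsFormOperator J T) {z : ℂ} {x : H} :
    x ∈ eigenspace T z ↔ (1 + z) • gram J x = x := by
  have h : x ∈ eigenspace T z ↔ (x, z • x) ∈ T.graph := Iff.rfl
  rw [h, hT, map_add, map_smul, add_smul, one_smul, add_comm]

/-- Pairing x = (1 + z)JJ*x with x gives ‖x‖² = (1 + z)‖J*x‖², so 1 + z is a quotient of positive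
numbers. -/
lemma IsFormOperator.eq_ofReal (hT : IsFormOperator J T) {z : ℂ} {x : H}
    (hx : x ∈ eigenspace T z) (hx0 : x ≠ 0) : ∃ r : ℝ, z = r ∧ -1 < r := by
  rw [hT.mem_eigenspace] at hx
  have h1 : (‖x‖ : ℂ) ^ 2 = (1 + z) * (‖ContinuousLinearMap.adjoint J x‖ : ℂ) ^ 2 := by
    have h2 : ⟪x, (1 + z) • gram J x⟫_ℂ = ⟪x, x⟫_ℂ := by rw [hx]
    rw [inner_smul_right, inner_gram, inner_self_eq_norm_sq_to_K, inner_self_eq_norm_sq_to_K] at h2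
    exact h2.symm
  set q := ‖ContinuousLinearMap.adjoint J x‖ ^ 2 with hq
  set p := ‖x‖ ^ 2 with hp
  have hp0 : 0 < p := by positivity
  have h3 : (p : ℂ) = (1 + z) * (q : ℂ) := by rw [hp, hq]; push_cast; exact h1
  have hq0 : q ≠ 0 := by
    intro h
    rw [h] at h3
    simp only [Complex.ofReal_zero, mul_zero, Complex.ofReal_eq_zero] at h3
    exact hp0.ne' h3
  have hq1 : 0 < q := lt_of_le_of_ne (sq_nonneg _) (Ne.symm hq0)
  refine ⟨p / q - 1, ?_, ?_⟩
  · have : (q : ℂ) ≠ 0 := by exact_mod_cast hq0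
    push_cast
    field_simp
    rw [h3]; ring
  · have := div_pos hp0 hq1
    linarith

lemma IsFormOperator.gram_apply (hT : IsFormOperator J T) {r : ℝ} {x : H}
    (hx : x ∈ eigenspace T (r : ℂ)) (hx0 : x ≠ 0) : gram J x = (((1 + r)⁻¹ : ℝ) : ℂ) • x := by
  obtain ⟨s, hs, hs1⟩ := hT.eq_ofReal hx hx0
  obtain rfl : r = s := by exact_mod_cast hs
  rw [hT.mem_eigenspace] at hx
  have h : (1 + r : ℂ) ≠ 0 := by
    have : (1 + r : ℝ) ≠ 0 := by linarith
    exact_mod_cast this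
  conv_rhs => rw [← hx]
  rw [smul_smul]
  push_cast
  rw [inv_mul_cancel₀ h, one_smul]

lemma IsFormOperator.inner_eq_zero (hT : IsFormOperator J T) {z w : ℂ} (hzw : z ≠ w) {x y : H}
    (hx : x ∈ eigenspace T z) (hy : y ∈ eigenspace T w) : ⟪x, y⟫_ℂ = 0 := by
  by_cases hx0 : x = 0
  · simp [hx0]
  by_cases hy0 : y = 0
  · simp [hy0]
  obtain ⟨r, rfl, hr⟩ := hT.eq_ofReal hx hx0
  obtain ⟨s, rfl, hs⟩ := hT.eq_ofReal hy hy0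
  have h1 := gram_isSymmetric J x y
  rw [ContinuousLinearMap.coe_coe, hT.gram_apply hx hx0, hT.gram_apply hy hy0, inner_smul_left,
    inner_smul_right, Complex.conj_ofReal] at h1
  by_contra hne
  have h2 := mul_right_cancel₀ hne h1
  have h3 : (1 + r)⁻¹ = (1 + s)⁻¹ := by exact_mod_cast h2
  rw [inv_inj] at h3
  exact hzw (by rw [add_left_cancel h3])

lemma IsFormOperator.finiteDimensional (hT : IsFormOperator J T) (hJ : IsCompactOperator J)
    (z : ℂ) : FiniteDimensional ℂ (eigenspace T z) := by
  by_cases hz : 1 + z = 0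
  · have h : eigenspace T z = ⊥ := by
      rw [eq_bot_iff]
      intro x hx
      rw [hT.mem_eigenspace, hz, zero_smul] at hx
      exact hx.symm
    rw [h]; infer_instance
  · have hle : eigenspace T z ≤ Module.End.eigenspace (gram J).toLinearMap (1 + z)⁻¹ := by
      intro x hx
      rw [hT.mem_eigenspace] at hx
      rw [Module.End.mem_eigenspace_iff, ContinuousLinearMap.coe_coe]
      conv_rhs => rw [← hx]
      rw [smul_smul, inv_mul_cancel₀ hz, one_smul]
    have := ContinuousLinearMap.finite_dimensional_eigenspace (gram_isCompactOperator hJ)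
      (1 + z)⁻¹ (inv_ne_zero hz)
    exact Submodule.finiteDimensional_of_le hle

/-- Orthonormal eigenvectors which exhaust all eigenspaces. -/
lemma IsFormOperator.exists_orthonormal (hT : IsFormOperator J T) (hJ : IsCompactOperator J)
    {ι : Type*} (z : ι → ℝ)
    (hz : ∀ t : ℝ, Nonempty ({i // z i = t} ≃ Fin (Module.finrank ℂ (eigenspace T (t : ℂ))))) :
    ∃ e : ι → H, Orthonormal ℂ e ∧ (∀ i, e i ∈ eigenspace T (z i : ℂ)) ∧
      ∀ t : ℝ, eigenspace T (t : ℂ) ≤ Submodule.span ℂ (e '' {i | z i = t}) := by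
  have := hT.finiteDimensional hJ
  let b (t : ℝ) := stdOrthonormalBasis ℂ (eigenspace T (t : ℂ))
  let q (t : ℝ) := (hz t).some
  -- The basis depends on the index through z i; this transport lets vectors with equal eigenvalues
  -- be compared inside one basis.
  have key : ∀ t : ℝ, ∀ i : ι, ∀ h : z i = t,
      ((b (z i) (q (z i) ⟨i, rfl⟩) : eigenspace T (z i : ℂ)) : H) = (b t (q t ⟨i, h⟩) : H) := by
    rintro t i rfl; rfl
  refine ⟨fun i => (b (z i) (q (z i) ⟨i, rfl⟩) : H), ⟨fun i => ?_, fun i j hij => ?_⟩,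
    fun i => (b (z i) _).2, fun t x hx => ?_⟩
  · exact (b (z i)).orthonormal.1 _
  · by_cases h : z i = z j
    · dsimp only
      rw [key (z j) i h, ← Submodule.coe_inner]
      refine (b (z j)).orthonormal.2 fun h' => hij ?_
      exact congrArg Subtype.val ((q (z j)).injective h')
    · exact hT.inner_eq_zero (by exact_mod_cast h) (b (z i) _).2 (b (z j) _).2
  · have h1 := congrArg Subtype.val ((b t).sum_repr ⟨x, hx⟩)
    simp only [Submodule.coe_sum, Submodule.coe_smul] at h1
    rw [← h1]
    refine Submodule.sum_mem _ fun k _ => Submodule.smul_mem _ _ (Submodule.subset_span ?_)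
    refine ⟨((q t).symm k).1, ((q t).symm k).2, ?_⟩
    dsimp only
    rw [key t _ ((q t).symm k).2]
    simp

/-- The compactness of the resolvent: only finitely many orthonormal eigenvectors belong to
eigenvalues below a given bound. -/
lemma IsFormOperator.finite_setOf_le (hT : IsFormOperator J T) (hJ : IsCompactOperator J)
    {ι : Type*} {z : ι → ℝ} {e : ι → H} (he : Orthonormal ℂ e)
    (hz : ∀ i, e i ∈ eigenspace T (z i : ℂ)) (t : ℝ) : {i | z i ≤ t}.Finite := by
  by_contra hinf
  have hinf : {i | z i ≤ t}.Infinite := hinf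
  obtain ⟨C, hC, hsub⟩ := (gram_isCompactOperator hJ).image_closedBall_subset_compact 1
  obtain ⟨i₀, hi₀⟩ := hinf.nonempty
  have hz1 : ∀ i, -1 < z i := fun i => by
    obtain ⟨r, hr, h⟩ := hT.eq_ofReal (hz i) (he.ne_zero i)
    have : z i = r := by exact_mod_cast hr
    rwa [this]
  have ht : 0 < 1 + t := by
    have : z i₀ ≤ t := hi₀
    linarith [hz1 i₀]
  -- Every eᵢ with zᵢ ≤ t has JJ*-eigenvalue at least c, so ⟨eᵢ, JJ*eᵢ - JJ*eⱼ⟩ ≥ c for i ≠ j and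
  -- the images are c-separated. Infinitely many of them cannot fit into a totally bounded set: two
  -- would share a ball of radius c/2.
  set c : ℝ := (1 + t)⁻¹ with hc
  have hc0 : 0 < c := by positivity
  obtain ⟨s, hs, hcov⟩ := Metric.totallyBounded_iff.1 hC.totallyBounded (c / 2) (by positivity)
  have hmem : ∀ i, ∃ y ∈ s, gram J (e i) ∈ Metric.ball y (c / 2) := fun i => by
    have : gram J (e i) ∈ C := hsub ⟨e i, by simp [he.1 i], rfl⟩
    simpa using hcov this
  choose f hfs hf using hmem
  obtain ⟨i, hi, j, hj, hij, hfij⟩ :=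
    hinf.exists_ne_map_eq_of_mapsTo (f := f) (fun i _ => hfs i) hs
  have hdist : dist (gram J (e i)) (gram J (e j)) < c := by
    have h1 := Metric.mem_ball.1 (hf i)
    have h2 := Metric.mem_ball.1 (hf j)
    rw [← hfij] at h2
    have := dist_triangle_right (gram J (e i)) (gram J (e j)) (f i)
    linarith
  have hnn : ‖⟪e i, gram J (e i) - gram J (e j)⟫_ℂ‖ < c := by
    refine (norm_inner_le_norm _ _).trans_lt ?_
    rw [he.1 i, one_mul, ← dist_eq_norm]
    exact hdist
  rw [hT.gram_apply (hz i) (he.ne_zero i), hT.gram_apply (hz j) (he.ne_zero j), inner_sub_right,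
    inner_smul_right, inner_smul_right, he.2 hij, inner_self_eq_norm_sq_to_K, he.1 i] at hnn
  have h2 : c ≤ (1 + z i)⁻¹ := by
    have h3 := hz1 i
    have h4 : z i ≤ t := hi
    exact inv_anti₀ (by linarith) (by linarith)
  have h5 : ‖(((1 + z i)⁻¹ : ℝ) : ℂ)‖ = (1 + z i)⁻¹ := by
    rw [Complex.norm_real, Real.norm_of_nonneg (hc0.le.trans h2)]
  simp only [RCLike.ofReal_one, one_pow, mul_one, mul_zero, sub_zero] at hnn
  rw [h5] at hnn
  linarith

/-- Every eigenvector of `J J*` with a positive eigenvalue is an eigenvector of `T`. -/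
lemma IsFormOperator.mem_eigenspace_of_gram (hT : IsFormOperator J T) {ν : ℝ} (hν : 0 < ν) {y : H}
    (hy : gram J y = (ν : ℂ) • y) : y ∈ eigenspace T ((ν⁻¹ - 1 : ℝ) : ℂ) := by
  rw [hT.mem_eigenspace, hy, smul_smul]
  have h : (ν : ℂ) ≠ 0 := by exact_mod_cast hν.ne'
  push_cast
  rw [add_sub_cancel, inv_mul_cancel₀ h, one_smul]

/-- An operator with compact resolvent on an infinite-dimensional space has an enumeration of its
eigenvalues. -/
theorem IsFormOperator.exists_enumeration (hT : IsFormOperator J T) (hJ : IsCompactOperator J)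
    (hinf : ¬ FiniteDimensional ℂ J.toLinearMap.range) :
    ∃ σ : ℕ → ℝ, IsEigenvalueEnumeration T σ := by
  have hfd := hT.finiteDimensional hJ
  let d (t : ℝ) : ℕ := Module.finrank ℂ (eigenspace T (t : ℂ))
  -- One index (t, k) for each k below the multiplicity of t, in lexicographic order. Numbering S by
  -- ℕ in this order is the required enumeration.
  let S : Type := {p : ℝ ×ₗ ℕ // (ofLex p).2 < d (ofLex p).1}
  let z : S → ℝ := fun p => (ofLex p.1).1
  let q (t : ℝ) : {i // z i = t} ≃ Fin (d t) :=
    { toFun := fun i => ⟨(ofLex i.1.1).2, i.1.2.trans_eq (congrArg d i.2)⟩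
      invFun := fun k => ⟨⟨toLex (t, k), k.2⟩, rfl⟩
      left_inv := by rintro ⟨⟨p, hp⟩, rfl⟩; rfl
      right_inv := fun k => rfl }
  obtain ⟨e, he, hez, hspan⟩ := hT.exists_orthonormal hJ z fun t => ⟨q t⟩
  have hfin : ∀ t, {i | z i ≤ t}.Finite := hT.finite_setOf_le hJ he hez
  have hmono : Monotone z := fun a b hab => by
    rcases Prod.Lex.le_iff.1 (show a.1 ≤ b.1 from hab) with h | h
    · exact h.le
    · exact h.1.le
  have hIic : ∀ b : S, (Set.Iic b).Finite := fun b => (hfin (z b)).subset fun a ha => hmono ha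
  -- If S were finite, all eigenvectors of T would span a finite-dimensional M. For x ⊥ M the bound
  -- on J*x holds with every μ > 0, so J*x = 0 and x ⊥ range J. Thus range J ⊆ Mᗮᗮ = M, against
  -- `hinf`.
  have hSinf : Infinite S := by
    by_contra hS
    rw [not_infinite_iff_finite] at hS
    apply hinf
    let M := Submodule.span ℂ (Set.range e)
    have hM : FiniteDimensional ℂ M := FiniteDimensional.span_of_finite ℂ (Set.finite_range e)
    have hle : J.toLinearMap.range ≤ M := by
      rw [← Submodule.orthogonal_orthogonal M]
      rintro _ ⟨φ, rfl⟩ x hx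
      have h0 : ∀ μ : ℝ, 0 < μ → ‖ContinuousLinearMap.adjoint J x‖ ^ 2 ≤ μ * ‖x‖ ^ 2 := by
        intro μ hμ
        refine norm_adjoint_sq_le hJ hμ.le x fun ν hν y hy => ?_
        have hyM : y ∈ M := Submodule.span_mono (Set.image_subset_range _ _)
          (hspan _ (hT.mem_eigenspace_of_gram (hμ.trans hν) hy))
        exact hx y hyM
      have h1 : ‖ContinuousLinearMap.adjoint J x‖ ^ 2 ≤ 0 := by
        refine le_of_forall_pos_le_add fun ε hε => ?_
        refine (h0 (ε / (‖x‖ ^ 2 + 1)) (by positivity)).trans ?_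
        rw [zero_add, div_mul_eq_mul_div, div_le_iff₀ (by positivity)]
        nlinarith
      have h2 : ContinuousLinearMap.adjoint J x = 0 := by
        rw [← norm_eq_zero]; exact pow_eq_zero_iff two_ne_zero |>.1 (le_antisymm h1 (sq_nonneg _))
      rw [ContinuousLinearMap.coe_coe, ← ContinuousLinearMap.adjoint_inner_left, h2,
        inner_zero_left]
    exact Submodule.finiteDimensional_of_le hle
  -- S is an infinite linear order with finite initial segments: it is locally finite, has a least
  -- element and no greatest one, and is therefore isomorphic to ℕ.
  let _ : LocallyFiniteOrder S := LocallyFiniteOrder.ofFiniteIcc fun a b =>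
    (hIic b).subset Set.Icc_subset_Iic_self
  have : NoMaxOrder S := ⟨fun a => by
    by_contra! h
    exact Set.infinite_univ ((hIic a).subset fun b _ => not_lt.1 (h b))⟩
  obtain ⟨s₀⟩ : Nonempty S := inferInstance
  obtain ⟨m, hm⟩ := (hIic s₀).exists_minimal ⟨s₀, Set.mem_Iic.2 le_rfl⟩
  let _ : OrderBot S :=
    { bot := m
      bot_le := fun a => by
        rcases le_total m a with h | h
        · exact h
        · exact hm.2 (y := a) (h.trans hm.1) h }
  let _ : SuccOrder S := LinearLocallyFiniteOrder.succOrder S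
  let _ : PredOrder S := LinearLocallyFiniteOrder.predOrder S
  let iso : S ≃o ℕ := orderIsoNatOfLinearSuccPredArch
  refine ⟨fun k => z (iso.symm k), fun a b hab => hmono (iso.symm.monotone hab), fun w => ?_⟩
  have := hfd w
  rw [← Module.finrank_eq_rank, Cardinal.toENat_nat]
  by_cases hw : ∃ t : ℝ, w = t
  · obtain ⟨t, rfl⟩ := hw
    let r : {m : ℕ | ((z (iso.symm m) : ℝ) : ℂ) = t} ≃ Fin (d t) :=
      (iso.symm.toEquiv.subtypeEquiv (q := fun i => z i = t) fun a => by simp).trans (q t)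
    rw [Set.encard_congr (r.trans (Equiv.Set.univ _).symm), Set.encard_univ]
    simp [d]
  · have h1 : {m : ℕ | ((z (iso.symm m) : ℝ) : ℂ) = w} = ∅ := by
      ext m
      simp only [Set.mem_ofPred_eq, Set.mem_empty_iff_false, iff_false]
      exact fun h => hw ⟨_, h.symm⟩
    have h2 : eigenspace T w = ⊥ := by
      rw [eq_bot_iff]
      intro x hx
      by_contra hx0
      obtain ⟨r, hr, _⟩ := hT.eq_ofReal hx hx0
      exact hw ⟨r, hr⟩
    rw [h1, h2]; simp

lemma IsFormOperator.exists_orthonormal_of_enumeration (hT : IsFormOperator J T)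
    (hJ : IsCompactOperator J) {σ : ℕ → ℝ} (hσ : IsEigenvalueEnumeration T σ) :
    ∃ e : ℕ → H, Orthonormal ℂ e ∧ (∀ i, e i ∈ eigenspace T (σ i : ℂ)) ∧
      ∀ t : ℝ, eigenspace T (t : ℂ) ≤ Submodule.span ℂ (e '' {i | σ i = t}) := by
  refine hT.exists_orthonormal hJ σ fun t => ?_
  have := hT.finiteDimensional hJ t
  have h := hσ.multiplicity t
  rw [← Module.finrank_eq_rank, Cardinal.toENat_nat] at h
  simp only [Complex.ofReal_inj] at h
  have hfin : {m | σ m = t}.Finite := Set.finite_of_encard_eq_coe h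
  have : Finite {m // σ m = t} := hfin
  refine ⟨Finite.equivFinOfCardEq ?_⟩
  rw [hfin.encard_eq_coe_toFinset_card, ← Set.ncard_eq_toFinset_card _ hfin] at h
  exact_mod_cast h

end CompactResolvent

/-! ### Min-max comparison along a linear relation -/

section MinMax

variable {V W H : Type*} [NormedAddCommGroup V] [InnerProductSpace ℂ V] [CompleteSpace V]
  [NormedAddCommGroup W] [InnerProductSpace ℂ W] [CompleteSpace W]
  [NormedAddCommGroup H] [InnerProductSpace ℂ H] [CompleteSpace H]

/-- Comparison of eigenvalues by the min-max principle. The forms of `T` and `S` are compared along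
a linear relation `R` between the form domains which preserves the norm of `H`. -/
theorem eigenvalue_add_le {J : V →L[ℂ] H} {L : W →L[ℂ] H} (hJ : IsCompactOperator J)
    (hL : IsCompactOperator L) {T S : H →ₗ.[ℂ] H} (hT : IsFormOperator J T)
    (hS : IsFormOperator L S) (R : Submodule ℂ (V × W)) (δ : ℝ)
    (hR : ∀ x : V, ∃ y : W, (x, y) ∈ R)
    (hnorm : ∀ x y, (x, y) ∈ R → ‖L y‖ = ‖J x‖)
    (hle : ∀ x y, (x, y) ∈ R → ‖y‖ ^ 2 + δ * ‖J x‖ ^ 2 ≤ ‖x‖ ^ 2)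
    {σ τ : ℕ → ℝ} (hσ : IsEigenvalueEnumeration T σ) (hτ : IsEigenvalueEnumeration S τ) (m : ℕ) :
    τ m + δ ≤ σ m := by
  obtain ⟨e, he, hez, -⟩ := hT.exists_orthonormal_of_enumeration hJ hσ
  obtain ⟨f, hf, hfz, hspan⟩ := hS.exists_orthonormal_of_enumeration hL hτ
  have hσ1 : ∀ k, -1 < σ k := fun k => by
    obtain ⟨r, hr, h⟩ := hT.eq_ofReal (hez k) (he.ne_zero k)
    have : σ k = r := by exact_mod_cast hr
    rwa [this]
  have hτ1 : -1 < τ m := by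
    obtain ⟨r, hr, h⟩ := hS.eq_ofReal (hfz m) (hf.ne_zero m)
    have : τ m = r := by exact_mod_cast hr
    rwa [this]
  -- The eigenvector e k lifted to the form domain: the eigenvalue equation says that J maps (1 +
  -- σₖ)J*eₖ back to eₖ.
  let G : Fin (m + 1) → V := fun k =>
    ContinuousLinearMap.adjoint J (((1 + σ k : ℝ) : ℂ) • e k)
  have hJG : ∀ k, J (G k) = e k := fun k => by
    have h := hT.mem_eigenspace.1 (hez k)
    rw [← map_smul] at h
    simpa [G, gram] using h
  choose F hF using fun k => hR (G k)
  -- There are m + 1 coefficients and m conditions ⟨fⱼ, Ly⟩ = 0, j < m. So some nonzero combination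
  -- x of the lifts has a partner y with Ly orthogonal to f₀, …, fₘ₋₁; linearity of R keeps (x, y)
  -- in R.
  let A : (Fin (m + 1) → ℂ) →ₗ[ℂ] (Fin m → ℂ) := LinearMap.pi fun j =>
    ((innerSL ℂ (f j)).comp L).toLinearMap.comp (Fintype.linearCombination ℂ F)
  obtain ⟨c, hc, hc0⟩ := (Submodule.ne_bot_iff _).1
    (A.ker_ne_bot_of_finrank_lt (by simp))
  set x : V := ∑ k, c k • G k with hx
  set y : W := ∑ k, c k • F k with hy
  have hxy : (x, y) ∈ R := by
    have : (x, y) = ∑ k, c k • (G k, F k) := by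
      simp [hx, hy, Prod.ext_iff, Prod.fst_sum, Prod.snd_sum]
    rw [this]
    exact Submodule.sum_mem _ fun k _ => R.smul_mem _ (hF k)
  have hAy : ∀ j : Fin m, ⟪f j, L y⟫_ℂ = 0 := fun j => by
    have := congrFun (LinearMap.mem_ker.1 hc) j
    simpa [A, Fintype.linearCombination_apply, ← map_smul, ← map_sum, ← hy] using this
  have hJx : J x = ∑ k, c k • e k := by simp [hx, hJG]
  have he' : Orthonormal ℂ fun k : Fin (m + 1) => e k :=
    he.comp _ Fin.val_injective
  have hnJ : ‖J x‖ ^ 2 = ∑ k, ‖c k‖ ^ 2 := by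
    have h := he'.inner_sum c c Finset.univ
    rw [← hJx, inner_self_eq_norm_sq_to_K] at h
    simp only [Complex.conj_mul'] at h
    have h' := congrArg Complex.re h
    norm_cast at h'
  have hpos : 0 < ‖J x‖ ^ 2 := by
    rw [hnJ]
    obtain ⟨k, hk⟩ := Function.ne_iff.1 hc0
    refine Finset.sum_pos' (fun _ _ => by positivity) ⟨k, Finset.mem_univ _, ?_⟩
    have : c k ≠ 0 := hk
    positivity
  have hnx : ‖x‖ ^ 2 = ∑ k : Fin (m + 1), (1 + σ k) * ‖c k‖ ^ 2 := by
    have h : ⟪x, x⟫_ℂ = ∑ k : Fin (m + 1), ((1 + σ k : ℝ) : ℂ) * (‖c k‖ : ℂ) ^ 2 := by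
      conv_lhs => rw [hx, sum_inner]
      refine Finset.sum_congr rfl fun k _ => ?_
      rw [inner_smul_left, ← hx, ContinuousLinearMap.adjoint_inner_left, inner_smul_left, hJx,
        he'.inner_right_fintype, Complex.conj_ofReal, mul_left_comm, Complex.conj_mul']
    rw [inner_self_eq_norm_sq_to_K] at h
    have h' := congrArg Complex.re h
    norm_cast at h'
  have hup : ‖x‖ ^ 2 ≤ (1 + σ m) * ‖J x‖ ^ 2 := by
    rw [hnx, hnJ, Finset.mul_sum]
    refine Finset.sum_le_sum fun k _ => ?_
    have := hσ.monotone (Nat.lt_succ_iff.1 k.2)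
    gcongr
  -- An eigenvalue ν > (1 + τₘ)⁻¹ of LL* belongs to the eigenvalue ν⁻¹ - 1 < τₘ of S. By
  -- monotonicity its eigenvectors lie in the span of the fᵢ with i < m, to which Ly is orthogonal.
  have hlow : ‖L y‖ ^ 2 ≤ (1 + τ m)⁻¹ * ‖y‖ ^ 2 := by
    have h1 : 0 < 1 + τ m := by linarith
    refine norm_apply_sq_le hL (by positivity) y fun ν hν w hw => ?_
    have hν0 : 0 < ν := lt_trans (by positivity) hν
    have hmem := hspan _ (hS.mem_eigenspace_of_gram hν0 hw)
    have hlt : ν⁻¹ - 1 < τ m := by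
      have := (inv_lt_comm₀ h1 hν0).1 hν
      linarith
    have hker : Submodule.span ℂ (f '' {i | τ i = ν⁻¹ - 1}) ≤ (Submodule.span ℂ {L y})ᗮ := by
      rw [Submodule.span_le]
      rintro _ ⟨i, hi, rfl⟩
      have him : i < m := by
        by_contra! h
        exact absurd (hτ.monotone h) (not_le.2 ((show τ i = _ from hi).trans_lt hlt))
      rw [SetLike.mem_coe, Submodule.mem_orthogonal_singleton_iff_inner_left]
      exact hAy ⟨i, him⟩
    exact Submodule.mem_orthogonal_singleton_iff_inner_left.1 (hker hmem)
  have h1 : 0 < 1 + τ m := by linarith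
  rw [inv_mul_eq_div, le_div_iff₀ h1, hnorm x y hxy] at hlow
  have h2 := hle x y hxy
  have h3 : (1 + τ m + δ) * ‖J x‖ ^ 2 ≤ (1 + σ m) * ‖J x‖ ^ 2 := by nlinarith
  have := le_of_mul_le_mul_right h3 hpos
  linarith

end MinMax

/-! ### The form domain as a Hilbert space -/

lemma inner_self_eq_ofReal {E : Type*} [NormedAddCommGroup E] [InnerProductSpace ℂ E] (x : E) :
    ⟪x, x⟫_ℂ = ((‖x‖ ^ 2 : ℝ) : ℂ) := by
  rw [inner_self_eq_norm_sq_to_K]; push_cast; rfl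

/-- The real quadratic form which belongs to `energy`. -/
def quadForm (B a : ℝ) (G : L2Strip × L2Strip × L2Strip × L2Strip) : ℝ :=
  ‖G.2.1‖ ^ 2 + (a ^ 2)⁻¹ * ‖G.2.2.1‖ ^ 2 + B ^ 2 * ‖G.2.2.2‖ ^ 2

lemma continuous_quadForm (B a : ℝ) : Continuous (quadForm B a) := by
  unfold quadForm
  fun_prop

/-- The weights of the form, as a continuous linear map. -/
def weightMap (B a : ℝ) : PiLp 2 (fun _ : Fin 4 => L2Strip) →L[ℂ]
    L2Strip × L2Strip × L2Strip × L2Strip :=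
  (PiLp.proj 2 _ 0).prod ((PiLp.proj 2 _ 1).prod
    (((a : ℂ) • PiLp.proj 2 _ 2).prod (((B⁻¹ : ℝ) : ℂ) • PiLp.proj 2 _ 3)))

lemma weightMap_apply (B a : ℝ) (x : PiLp 2 (fun _ : Fin 4 => L2Strip)) :
    weightMap B a x = (x 0, x 1, (a : ℂ) • x 2, ((B⁻¹ : ℝ) : ℂ) • x 3) := rfl

/-- The factors a and B⁻¹ in `weightMap` cancel the weights a⁻² and B² of the form. The ℓ² product
thus carries exactly the form inner product plus that of L². -/
lemma inner_eq_energy {B a : ℝ} (hB : B ≠ 0) (ha : a ≠ 0)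
    (x y : PiLp 2 (fun _ : Fin 4 => L2Strip)) :
    ⟪x, y⟫_ℂ = ⟪x 0, y 0⟫_ℂ + energy B a (weightMap B a x) (weightMap B a y) := by
  have ha' : (a : ℂ) ≠ 0 := by exact_mod_cast ha
  have hB' : (B : ℂ) ≠ 0 := by exact_mod_cast hB
  rw [PiLp.inner_apply, Fin.sum_univ_four, weightMap_apply, weightMap_apply, energy]
  simp only [inner_smul_left, inner_smul_right, Complex.conj_ofReal]
  push_cast
  field_simp
  ring

/-- The form domain of `H_α`, with the inner product given by the form. -/
def formSpace (α B a : ℝ) : Submodule ℂ (PiLp 2 (fun _ : Fin 4 => L2Strip)) :=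
  (formGraph α a).comap (weightMap B a).toLinearMap

instance (α B a : ℝ) : CompleteSpace (formSpace α B a) :=
  ((coreGraph α a).isClosed_topologicalClosure.preimage
    (weightMap B a).continuous).completeSpace_coe

/-- The embedding of the form domain in `L²`. -/
def embed (α B a : ℝ) : formSpace α B a →L[ℂ] L2Strip :=
  (PiLp.proj 2 (fun _ : Fin 4 => L2Strip) 0).comp (formSpace α B a).subtypeL

lemma embed_apply (α B a : ℝ) (x : formSpace α B a) : embed α B a x = (weightMap B a x).1 := rfl

lemma exists_weightMap_eq {α B a : ℝ} (hB : B ≠ 0) (ha : a ≠ 0)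
    {G : L2Strip × L2Strip × L2Strip × L2Strip} (hG : G ∈ formGraph α a) :
    ∃ x : formSpace α B a, weightMap B a x = G := by
  have ha' : (a : ℂ) ≠ 0 := by exact_mod_cast ha
  have hB' : (B : ℂ) ≠ 0 := by exact_mod_cast hB
  have h : weightMap B a
      (WithLp.toLp 2 ![G.1, G.2.1, (a : ℂ)⁻¹ • G.2.2.1, (B : ℂ) • G.2.2.2]) = G := by
    refine Prod.ext rfl (Prod.ext rfl (Prod.ext ?_ ?_))
    · change (a : ℂ) • (a : ℂ)⁻¹ • G.2.2.1 = _
      rw [smul_smul, mul_inv_cancel₀ ha', one_smul]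
    · change ((B⁻¹ : ℝ) : ℂ) • (B : ℂ) • G.2.2.2 = _
      rw [smul_smul, Complex.ofReal_inv, inv_mul_cancel₀ hB', one_smul]
  exact ⟨⟨_, show weightMap B a _ ∈ formGraph α a from h.symm ▸ hG⟩, h⟩

lemma norm_sq_eq_quadForm {B a : ℝ} (hB : B ≠ 0) (ha : a ≠ 0) (α : ℝ) (x : formSpace α B a) :
    ‖x‖ ^ 2 = ‖embed α B a x‖ ^ 2 + quadForm B a (weightMap B a x) := by
  have h := inner_eq_energy hB ha (x : PiLp 2 (fun _ : Fin 4 => L2Strip)) x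
  rw [energy] at h
  simp only [inner_self_eq_ofReal] at h
  norm_cast at h

/-- The vector y = J*(f + x) is characterised by q(w, y) + ⟨Jw, Jy⟩ = ⟨Jw, f⟩ + ⟨Jw, x⟩ for all w in
the form domain. When Jy = x, cancelling ⟨Jw, x⟩ leaves the defining identity of the operator. -/
theorem isFormOperator_modelOperator {B a : ℝ} (hB : B ≠ 0) (ha : a ≠ 0) (α : ℝ) :
    IsFormOperator (embed α B a) (modelOperator α B a) := by
  intro x f
  rw [modelOperator_graph]
  have hinner : ∀ w y : formSpace α B a, ⟪w, y⟫_ℂ = ⟪embed α B a w, embed α B a y⟫_ℂ +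
      energy B a (weightMap B a w) (weightMap B a y) := fun w y =>
    inner_eq_energy hB ha (w : PiLp 2 (fun _ : Fin 4 => L2Strip)) y
  constructor
  · rintro ⟨G, hG, rfl, h⟩
    obtain ⟨y, rfl⟩ := exists_weightMap_eq (B := B) hB ha hG
    have hy : ContinuousLinearMap.adjoint (embed α B a) (f + (weightMap B a y).1) = y := by
      refine ext_inner_left ℂ fun w => ?_
      rw [ContinuousLinearMap.adjoint_inner_right, hinner, inner_add_right, ← embed_apply,
        add_comm]
      exact congrArg _ (h _ w.2).symm
    rw [gram, ContinuousLinearMap.comp_apply, hy, embed_apply]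
  · intro h
    set y := ContinuousLinearMap.adjoint (embed α B a) (f + x) with hy
    have hyx : embed α B a y = x := h
    refine ⟨weightMap B a y, y.2, hyx, fun F hF => ?_⟩
    obtain ⟨w, rfl⟩ := exists_weightMap_eq (B := B) hB ha hF
    have h1 := hinner w y
    rw [hyx, hy, ContinuousLinearMap.adjoint_inner_right, inner_add_right, ← hy, add_comm] at h1
    exact (add_left_cancel h1).symm

/-! ### Integrals of test functions -/

lemma IsTestFunction.integrable_sq {φ : ℝ × ℝ → ℂ} (hφ : IsTestFunction φ) :
    Integrable (fun p => ‖φ p‖ ^ 2) := by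
  have h1 : HasCompactSupport (fun p => ‖φ p‖ ^ 2) :=
    HasCompactSupport.comp_left (g := fun z : ℂ => ‖z‖ ^ 2) hφ.compact (by simp)
  have h2 : Continuous (fun p => ‖φ p‖ ^ 2) := by
    have := hφ.smooth.continuous
    fun_prop
  exact h2.integrable_of_hasCompactSupport h1

lemma IsTestFunction.norm_toLp_sq {φ : ℝ × ℝ → ℂ} (hφ : IsTestFunction φ) :
    ‖hφ.memLp.toLp φ‖ ^ 2 = ∫ p, ‖φ p‖ ^ 2 := by
  have h := inner_toLp hφ hφ.memLp.coeFn_toLp hφ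
  simp only [inner_self_eq_ofReal, Complex.conj_mul'] at h
  have h2 : (∫ p, (‖φ p‖ : ℂ) ^ 2) = ((∫ p, ‖φ p‖ ^ 2 : ℝ) : ℂ) := by
    rw [← integral_complex_ofReal]
    push_cast
    rfl
  rw [h2] at h
  exact_mod_cast h

lemma IsTestFunction.fst_mul {φ : ℝ × ℝ → ℂ} (hφ : IsTestFunction φ) :
    IsTestFunction (fun p => (p.1 : ℂ) * φ p) := by
  simpa [tilt] using hφ.tilt_mul 1 0

lemma IsTestFunction.dS {φ : ℝ × ℝ → ℂ} (hφ : IsTestFunction φ) : IsTestFunction (dS φ) :=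
  hφ.fderiv_apply (1, 0)

lemma IsTestFunction.dU {φ : ℝ × ℝ → ℂ} (hφ : IsTestFunction φ) : IsTestFunction (dU φ) :=
  hφ.fderiv_apply (0, 1)

lemma IsTestFunction.integrable_fst_sq {φ : ℝ × ℝ → ℂ} (hφ : IsTestFunction φ) :
    Integrable (fun p => p.1 ^ 2 * ‖φ p‖ ^ 2) := by
  simpa [mul_pow] using hφ.fst_mul.integrable_sq

lemma IsTestFunction.integrable_tilt_sq {φ : ℝ × ℝ → ℂ} (hφ : IsTestFunction φ) (α a : ℝ) :
    Integrable (fun p => tilt α a p ^ 2 * ‖φ p‖ ^ 2) := by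
  simpa [mul_pow] using (hφ.tilt_mul α a).integrable_sq

lemma IsTestFunction.quadForm_quad {φ : ℝ × ℝ → ℂ} (hφ : IsTestFunction φ) (α B a : ℝ) :
    quadForm B a (hφ.quad α a) = (∫ p, ‖BentLayer.dS φ p‖ ^ 2) +
      (a ^ 2)⁻¹ * (∫ p, ‖BentLayer.dU φ p‖ ^ 2) + B ^ 2 * ∫ p, tilt α a p ^ 2 * ‖φ p‖ ^ 2 := by
  have h := (hφ.tilt_mul α a).norm_toLp_sq
  simp only [norm_mul, mul_pow, Complex.norm_real, Real.norm_eq_abs, sq_abs] at h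
  rw [quadForm, IsTestFunction.quad, h, (hφ.fderiv_apply (1, 0)).norm_toLp_sq,
    (hφ.fderiv_apply (0, 1)).norm_toLp_sq]
  rfl

/-- The lower bound of the harmonic oscillator. -/
theorem IsTestFunction.oscillator_le {φ : ℝ × ℝ → ℂ} (hφ : IsTestFunction φ) (w : ℝ) :
    w * ∫ p, ‖φ p‖ ^ 2 ≤
      (∫ p, ‖BentLayer.dS φ p‖ ^ 2) + w ^ 2 * ∫ p, p.1 ^ 2 * ‖φ p‖ ^ 2 := by
  let N : ℝ × ℝ → ℝ := fun p => ‖φ p‖ ^ 2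
  let D : ℝ × ℝ → ℝ := fun p => 2 * ⟪φ p, BentLayer.dS φ p⟫_ℝ
  have hN : ContDiff ℝ ∞ N := hφ.smooth.norm_sq ℝ
  have hNc : HasCompactSupport N := hφ.compact.comp_left (g := fun z : ℂ => ‖z‖ ^ 2) (by simp)
  have hD : ∀ p, fderiv ℝ N p (1, 0) = D p := fun p => by
    rw [show N = fun p => ‖φ p‖ ^ 2 from rfl, ((hφ.differentiable p).hasFDerivAt.norm_sq).fderiv]
    simp [D, BentLayer.dS]
    ring
  have hDc : Continuous D := by
    have := hφ.smooth.continuous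
    have := hφ.dS.smooth.continuous
    fun_prop
  have hDs : HasCompactSupport D := by
    have : D = fun p => fderiv ℝ N p (1, 0) := funext fun p => (hD p).symm
    rw [this]
    exact hNc.fderiv_apply ℝ _
  -- Integration by parts in s: ∫ s ∂ₛ|φ|² = -∫ |φ|². The claim is then the expansion of 0 ≤ ∫ |∂ₛφ
  -- + wsφ|².
  have key := integral_mul_fderiv_eq_neg_fderiv_mul_of_integrable
    (μ := (volume : Measure (ℝ × ℝ))) (f := fun p : ℝ × ℝ => p.1) (g := N) (v := (1, 0))
    (Continuous.integrable_of_hasCompactSupport (by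
        have : Continuous N := hN.continuous
        simp only [fderiv_fst]; fun_prop) hNc.mul_left)
    (Continuous.integrable_of_hasCompactSupport (by simp only [hD]; fun_prop)
      (by simp only [hD]; exact hDs.mul_left))
    (Continuous.integrable_of_hasCompactSupport (continuous_fst.mul hN.continuous) hNc.mul_left)
    (fun x _ => differentiableAt_fst) (fun x _ => (hN.differentiable (by simp)) x)
  simp only [hD, fderiv_fst, ContinuousLinearMap.coe_fst', one_mul] at key
  have hint : Integrable fun p : ℝ × ℝ => p.1 * D p :=
    (continuous_fst.mul hDc).integrable_of_hasCompactSupport hDs.mul_left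
  have hsum : 0 ≤ ∫ p : ℝ × ℝ, (‖BentLayer.dS φ p‖ ^ 2 + w ^ 2 * (p.1 ^ 2 * ‖φ p‖ ^ 2) +
      w * (p.1 * D p)) := by
    refine integral_nonneg fun p => ?_
    have h := norm_add_sq_real (BentLayer.dS φ p) ((w * p.1) • φ p)
    rw [norm_smul, inner_smul_right, real_inner_comm, mul_pow, Real.norm_eq_abs, sq_abs] at h
    have h0 := sq_nonneg ‖BentLayer.dS φ p + (w * p.1) • φ p‖
    simp only [D, Pi.zero_apply]
    nlinarith
  have hadd : Integrable fun p : ℝ × ℝ =>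
      ‖BentLayer.dS φ p‖ ^ 2 + w ^ 2 * (p.1 ^ 2 * ‖φ p‖ ^ 2) :=
    hφ.dS.integrable_sq.add (hφ.integrable_fst_sq.const_mul _)
  rw [integral_add hadd (hint.const_mul _),
    integral_add hφ.dS.integrable_sq (hφ.integrable_fst_sq.const_mul _),
    integral_const_mul, integral_const_mul, key] at hsum
  linarith

/-! ### Dilations along the strip -/

/-- The dilation `φ ↦ √κ φ(κ s, u)`, which preserves the `L²` norm. -/
def dilate (κ : ℝ) (φ : ℝ × ℝ → ℂ) (p : ℝ × ℝ) : ℂ := (√κ : ℂ) * φ (κ * p.1, p.2)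

lemma IsTestFunction.dilate {κ : ℝ} (hκ : 0 < κ) {φ : ℝ × ℝ → ℂ} (hφ : IsTestFunction φ) :
    IsTestFunction (dilate κ φ) := by
  let h : ℝ × ℝ ≃ₜ ℝ × ℝ := (Homeomorph.mulLeft₀ κ hκ.ne').prodCongr (Homeomorph.refl ℝ)
  have hc : IsTestFunction (φ ∘ h) := by
    refine ⟨hφ.smooth.comp ?_, hφ.compact.comp_homeomorph h, ?_⟩
    · change ContDiff ℝ ∞ fun p : ℝ × ℝ => (κ * p.1, p.2)
      fun_prop
    · rw [tsupport_comp_eq_preimage]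
      intro p hp
      have := hφ.supp hp
      simpa [strip, h] using this
  exact hc.smul (√κ : ℂ)

lemma integral_comp_dilate {κ : ℝ} (hκ : 0 < κ) {F : ℝ × ℝ → ℝ} (hF : Integrable F)
    (hF' : Integrable fun p : ℝ × ℝ => F (κ * p.1, p.2)) :
    ∫ p : ℝ × ℝ, F (κ * p.1, p.2) = κ⁻¹ * ∫ p, F p := by
  rw [Measure.volume_eq_prod] at hF hF' ⊢
  rw [integral_prod_symm _ hF, integral_prod_symm _ hF', ← integral_const_mul]
  refine integral_congr_ae (Filter.Eventually.of_forall fun u => ?_)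
  simp only
  rw [Measure.integral_comp_mul_left (fun s => F (s, u)) κ, abs_of_pos (inv_pos.2 hκ), smul_eq_mul]

lemma dS_dilate (κ : ℝ) {φ : ℝ × ℝ → ℂ} (hφ : IsTestFunction φ) (p : ℝ × ℝ) :
    dS (dilate κ φ) p = (√κ : ℂ) * (κ * dS φ (κ * p.1, p.2)) := by
  have h : HasFDerivAt (fun q : ℝ × ℝ => (κ * q.1, q.2))
      ((κ • ContinuousLinearMap.fst ℝ ℝ ℝ).prod (ContinuousLinearMap.snd ℝ ℝ ℝ)) p :=
    (hasFDerivAt_fst.const_mul κ).prodMk hasFDerivAt_snd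
  have h2 := ((hφ.differentiable (κ * p.1, p.2)).hasFDerivAt.comp p h).const_mul (√κ : ℂ)
  have h3 : HasFDerivAt (dilate κ φ) _ p := h2
  have e : ((κ, 0) : ℝ × ℝ) = κ • ((1, 0) : ℝ × ℝ) := by simp
  have e2 : fderiv ℝ φ (κ * p.1, p.2) (κ, 0) = κ * fderiv ℝ φ (κ * p.1, p.2) (1, 0) := by
    rw [e, map_smul, Complex.real_smul]
  rw [dS, h3.fderiv, dS, ← e2]
  simp

lemma dU_dilate (κ : ℝ) {φ : ℝ × ℝ → ℂ} (hφ : IsTestFunction φ) (p : ℝ × ℝ) :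
    dU (dilate κ φ) p = (√κ : ℂ) * dU φ (κ * p.1, p.2) := by
  have h : HasFDerivAt (fun q : ℝ × ℝ => (κ * q.1, q.2))
      ((κ • ContinuousLinearMap.fst ℝ ℝ ℝ).prod (ContinuousLinearMap.snd ℝ ℝ ℝ)) p :=
    (hasFDerivAt_fst.const_mul κ).prodMk hasFDerivAt_snd
  have h2 := ((hφ.differentiable (κ * p.1, p.2)).hasFDerivAt.comp p h).const_mul (√κ : ℂ)
  have h3 : HasFDerivAt (dilate κ φ) _ p := h2
  rw [dU, h3.fderiv, dU]
  simp

lemma IsTestFunction.integral_dilate {κ : ℝ} (hκ : 0 < κ) {χ : ℝ × ℝ → ℂ}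
    (hχ : IsTestFunction χ) :
    ∫ p : ℝ × ℝ, ‖(√κ : ℂ) * χ (κ * p.1, p.2)‖ ^ 2 = ∫ p, ‖χ p‖ ^ 2 := by
  have h1 : ∀ p : ℝ × ℝ, ‖(√κ : ℂ) * χ (κ * p.1, p.2)‖ ^ 2 = κ * ‖χ (κ * p.1, p.2)‖ ^ 2 :=
    fun p => by
      rw [norm_mul, mul_pow, Complex.norm_real, Real.norm_eq_abs, sq_abs, Real.sq_sqrt hκ.le]
  have h2 := (hχ.dilate hκ).integrable_sq
  simp only [BentLayer.dilate, h1] at h2 ⊢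
  have h3 : Integrable fun p : ℝ × ℝ => ‖χ (κ * p.1, p.2)‖ ^ 2 := by
    simpa [← mul_assoc, hκ.ne'] using h2.const_mul κ⁻¹
  rw [integral_const_mul, integral_comp_dilate hκ (F := fun p => ‖χ p‖ ^ 2) hχ.integrable_sq h3,
    mul_inv_cancel_left₀ hκ.ne']

lemma IsTestFunction.integral_dilate_sq {κ : ℝ} (hκ : 0 < κ) {φ : ℝ × ℝ → ℂ}
    (hφ : IsTestFunction φ) : ∫ p, ‖BentLayer.dilate κ φ p‖ ^ 2 = ∫ p, ‖φ p‖ ^ 2 :=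
  hφ.integral_dilate hκ

lemma IsTestFunction.integral_dU_dilate_sq {κ : ℝ} (hκ : 0 < κ) {φ : ℝ × ℝ → ℂ}
    (hφ : IsTestFunction φ) :
    ∫ p, ‖BentLayer.dU (BentLayer.dilate κ φ) p‖ ^ 2 = ∫ p, ‖BentLayer.dU φ p‖ ^ 2 := by
  simp only [dU_dilate κ hφ]
  exact hφ.dU.integral_dilate hκ

lemma IsTestFunction.integral_dS_dilate_sq {κ : ℝ} (hκ : 0 < κ) {φ : ℝ × ℝ → ℂ}
    (hφ : IsTestFunction φ) :
    ∫ p, ‖BentLayer.dS (BentLayer.dilate κ φ) p‖ ^ 2 = κ ^ 2 * ∫ p, ‖BentLayer.dS φ p‖ ^ 2 := by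
  rw [← hφ.dS.integral_dilate hκ, ← integral_const_mul]
  refine integral_congr_ae (Filter.Eventually.of_forall fun p => ?_)
  simp only [dS_dilate κ hφ, norm_mul, mul_pow, Complex.norm_real, Real.norm_eq_abs, sq_abs]
  ring

lemma IsTestFunction.integral_fst_dilate_sq {κ : ℝ} (hκ : 0 < κ) {φ : ℝ × ℝ → ℂ}
    (hφ : IsTestFunction φ) :
    ∫ p : ℝ × ℝ, p.1 ^ 2 * ‖BentLayer.dilate κ φ p‖ ^ 2 =
      (κ ^ 2)⁻¹ * ∫ p : ℝ × ℝ, p.1 ^ 2 * ‖φ p‖ ^ 2 := by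
  have h : ∫ p : ℝ × ℝ, p.1 ^ 2 * ‖φ p‖ ^ 2 = ∫ p : ℝ × ℝ, ‖(p.1 : ℂ) * φ p‖ ^ 2 := by
    simp only [norm_mul, mul_pow, Complex.norm_real, Real.norm_eq_abs, sq_abs]
  rw [h, ← hφ.fst_mul.integral_dilate hκ, ← integral_const_mul]
  refine integral_congr_ae (Filter.Eventually.of_forall fun p => ?_)
  simp only [BentLayer.dilate, norm_mul, mul_pow, Complex.norm_real, Real.norm_eq_abs, sq_abs]
  field_simp

/-! ### Comparison of the forms -/

/-- Young's inequality for the cross term, from (εs + au)² ≥ 0 and u² ≤ 1; the term a²(1 - α²)u² is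
bounded by its value at |u| = 1. -/
lemma tilt_sq_le {α a ε : ℝ} (hα : 0 ≤ α) (hα1 : α ≤ 1) (hε : 0 < ε) {p : ℝ × ℝ} (hp : p ∈ strip) :
    tilt α a p ^ 2 ≤ (α ^ 2 + α * √(1 - α ^ 2) * ε) * p.1 ^ 2 +
      a ^ 2 * (1 - α ^ 2 + ε⁻¹ * (α * √(1 - α ^ 2))) := by
  obtain ⟨s, u⟩ := p
  have hu : -1 < u ∧ u < 1 := hp.2
  have hu2 : u ^ 2 ≤ 1 := by nlinarith
  have hb2 : √(1 - α ^ 2) ^ 2 = 1 - α ^ 2 := Real.sq_sqrt (by nlinarith)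
  have hb : 0 ≤ √(1 - α ^ 2) := Real.sqrt_nonneg _
  set b := √(1 - α ^ 2)
  have h1 : -(2 * a * s * u) ≤ ε * s ^ 2 + a ^ 2 * ε⁻¹ := by
    have h2 : 0 ≤ ε⁻¹ * (ε * s + a * u) ^ 2 := by positivity
    have h3 : ε⁻¹ * (ε * s + a * u) ^ 2 = ε * s ^ 2 + 2 * a * s * u + a ^ 2 * ε⁻¹ * u ^ 2 := by
      field_simp; ring
    have h4 : a ^ 2 * ε⁻¹ * u ^ 2 ≤ a ^ 2 * ε⁻¹ * 1 := by gcongr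
    linarith
  have h5 := mul_le_mul_of_nonneg_left h1 (mul_nonneg hα hb)
  have h6 : a ^ 2 * b ^ 2 * u ^ 2 ≤ a ^ 2 * b ^ 2 * 1 := by gcongr
  rw [← hb2]
  have h7 : tilt α a (s, u) = α * s - a * b * u := rfl
  rw [h7]
  nlinarith

/-- Young's inequality with the opposite sign. The nonnegative term a²(1 - α²)u² is dropped, which
is why the gap contains 1 - α₊² but no 1 - α₋². -/
lemma le_tilt_sq {α a ε : ℝ} (hα : 0 ≤ α) (hε : 0 < ε) {p : ℝ × ℝ} (hp : p ∈ strip) :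
    (α ^ 2 - α * √(1 - α ^ 2) * ε) * p.1 ^ 2 - a ^ 2 * (ε⁻¹ * (α * √(1 - α ^ 2))) ≤
      tilt α a p ^ 2 := by
  obtain ⟨s, u⟩ := p
  have hu : -1 < u ∧ u < 1 := hp.2
  have hu2 : u ^ 2 ≤ 1 := by nlinarith
  have hb : 0 ≤ √(1 - α ^ 2) := Real.sqrt_nonneg _
  simp only [tilt]
  set b := √(1 - α ^ 2)
  have h1 : 2 * a * s * u ≤ ε * s ^ 2 + a ^ 2 * ε⁻¹ := by
    have h2 : 0 ≤ ε⁻¹ * (ε * s - a * u) ^ 2 := by positivity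
    have h3 : ε⁻¹ * (ε * s - a * u) ^ 2 = ε * s ^ 2 - 2 * a * s * u + a ^ 2 * ε⁻¹ * u ^ 2 := by
      field_simp; ring
    have h4 : a ^ 2 * ε⁻¹ * u ^ 2 ≤ a ^ 2 * ε⁻¹ * 1 := by gcongr
    linarith
  have h5 := mul_le_mul_of_nonneg_left h1 (mul_nonneg hα hb)
  have h6 : 0 ≤ (a * b * u) ^ 2 := sq_nonneg _
  nlinarith

lemma IsTestFunction.eq_zero {φ : ℝ × ℝ → ℂ} (hφ : IsTestFunction φ) {p : ℝ × ℝ}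
    (hp : p ∉ strip) : φ p = 0 :=
  image_eq_zero_of_notMem_tsupport fun h => hp (hφ.supp h)

lemma IsTestFunction.integral_tilt_sq_le {φ : ℝ × ℝ → ℂ} (hφ : IsTestFunction φ) {α ε : ℝ}
    (a : ℝ) (hα : 0 ≤ α) (hα1 : α ≤ 1) (hε : 0 < ε) :
    ∫ p, tilt α a p ^ 2 * ‖φ p‖ ^ 2 ≤
      (α ^ 2 + α * √(1 - α ^ 2) * ε) * (∫ p : ℝ × ℝ, p.1 ^ 2 * ‖φ p‖ ^ 2) +
      a ^ 2 * (1 - α ^ 2 + ε⁻¹ * (α * √(1 - α ^ 2))) * ∫ p, ‖φ p‖ ^ 2 := by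
  rw [← integral_const_mul, ← integral_const_mul,
    ← integral_add (hφ.integrable_fst_sq.const_mul _) (hφ.integrable_sq.const_mul _)]
  refine integral_mono (hφ.integrable_tilt_sq α a)
    ((hφ.integrable_fst_sq.const_mul _).add (hφ.integrable_sq.const_mul _)) fun p => ?_
  by_cases hp : p ∈ strip
  · have := mul_le_mul_of_nonneg_right (tilt_sq_le (a := a) hα hα1 hε hp) (sq_nonneg ‖φ p‖)
    simp only
    linarith
  · simp [hφ.eq_zero hp]

lemma IsTestFunction.le_integral_tilt_sq {φ : ℝ × ℝ → ℂ} (hφ : IsTestFunction φ) {α ε : ℝ}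
    (a : ℝ) (hα : 0 ≤ α) (hε : 0 < ε) :
    (α ^ 2 - α * √(1 - α ^ 2) * ε) * (∫ p : ℝ × ℝ, p.1 ^ 2 * ‖φ p‖ ^ 2) -
      a ^ 2 * (ε⁻¹ * (α * √(1 - α ^ 2))) * (∫ p, ‖φ p‖ ^ 2) ≤
      ∫ p, tilt α a p ^ 2 * ‖φ p‖ ^ 2 := by
  rw [← integral_const_mul, ← integral_const_mul,
    ← integral_sub (hφ.integrable_fst_sq.const_mul _) (hφ.integrable_sq.const_mul _)]
  refine integral_mono ((hφ.integrable_fst_sq.const_mul _).sub (hφ.integrable_sq.const_mul _))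
    (hφ.integrable_tilt_sq α a) fun p => ?_
  by_cases hp : p ∈ strip
  · have := mul_le_mul_of_nonneg_right (le_tilt_sq (a := a) hα hε hp) (sq_nonneg ‖φ p‖)
    simp only
    linarith
  · simp [hφ.eq_zero hp]

/-- The lower bound for the gap between the eigenvalues of `H_{α₊}` and `H_{α₋}`. -/
def spectralGap (αm αp B a ε : ℝ) : ℝ :=
  B * (g αm (-ε) - g αp ε) -
    B ^ 2 * a ^ 2 * (1 - αp ^ 2 + ε⁻¹ * (αp * √(1 - αp ^ 2) + αm * √(1 - αm ^ 2)))

/-- After the dilation both kinetic and potential parts of the oscillator for g₊ become κ² times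
those for g₋. The unused fraction 1 - κ² of the latter is bounded below by its ground state energy,
and the Young constants supply the a² term of the gap. -/
theorem quadForm_dilate_add_le {αm αp B a ε : ℝ} (hαp : 0 < αp) (hαp1 : αp ≤ 1) (hαm : 0 < αm)
    (hB : 0 < B) (hε : 0 < ε) (hgp : 0 < g αp ε) (hg : g αp ε < g αm (-ε)) {κ : ℝ} (hκ : 0 < κ)
    (hκ2 : κ ^ 2 = g αp ε / g αm (-ε)) {ψ : ℝ × ℝ → ℂ} (hψ : IsTestFunction ψ) :
    quadForm B a ((hψ.dilate hκ).quad αp a) +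
      spectralGap αm αp B a ε * ‖hψ.memLp.toLp ψ‖ ^ 2 ≤ quadForm B a (hψ.quad αm a) := by
  have hgm : 0 < g αm (-ε) := hgp.trans hg
  have sp : αp ^ 2 + αp * √(1 - αp ^ 2) * ε = g αp ε ^ 2 := by
    rw [g, Real.sq_sqrt (by positivity)]
  have sm : αm ^ 2 - αm * √(1 - αm ^ 2) * ε = g αm (-ε) ^ 2 := by
    have h : 0 < αm ^ 2 + αm * √(1 - αm ^ 2) * -ε := Real.sqrt_pos.1 hgm
    rw [g, Real.sq_sqrt h.le]
    ring
  have h1 := (hψ.dilate hκ).integral_tilt_sq_le a hαp.le hαp1 hε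
  have h2 := hψ.le_integral_tilt_sq a hαm.le hε
  have h3 := hψ.oscillator_le (B * g αm (-ε))
  rw [hψ.integral_fst_dilate_sq hκ, hψ.integral_dilate_sq hκ, sp, hκ2] at h1
  rw [sm] at h2
  rw [(hψ.dilate hκ).quadForm_quad, hψ.quadForm_quad, hψ.integral_dU_dilate_sq hκ,
    hψ.integral_dS_dilate_sq hκ, hψ.norm_toLp_sq, hκ2, spectralGap]
  set N := ∫ p, ‖ψ p‖ ^ 2
  set A := ∫ p, ‖dS ψ p‖ ^ 2
  set S := ∫ p : ℝ × ℝ, p.1 ^ 2 * ‖ψ p‖ ^ 2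
  set Tp := ∫ p, tilt αp a p ^ 2 * ‖dilate κ ψ p‖ ^ 2
  set Tm := ∫ p, tilt αm a p ^ 2 * ‖ψ p‖ ^ 2
  set gp := g αp ε
  set gm := g αm (-ε)
  -- This identity, g₊²κ⁻² = κ²g₋², determines κ: the potential scales by the same factor κ² as the
  -- kinetic term.
  have e1 : gp ^ 2 * ((gp / gm)⁻¹ * S) = gp / gm * (gm ^ 2 * S) := by
    field_simp
  rw [e1] at h1
  have hr : gp / gm ≤ 1 := (div_le_one hgm).2 hg.le
  have h4 := mul_le_mul_of_nonneg_left h3 (sub_nonneg.2 hr)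
  have h5 := mul_le_mul_of_nonneg_left h1 (sq_nonneg B)
  have h6 := mul_le_mul_of_nonneg_left h2 (sq_nonneg B)
  have e2 : (1 - gp / gm) * (B * gm * N) = B * (gm - gp) * N := by
    field_simp
  rw [e2] at h4
  nlinarith

/-! ### The relation between the form domains -/

/-- The space of test functions. -/
def testSpace : Submodule ℂ (ℝ × ℝ → ℂ) where
  carrier := {φ | IsTestFunction φ}
  add_mem' := IsTestFunction.add
  zero_mem' := IsTestFunction.zero
  smul_mem' := fun c _ h => h.smul c

lemma toLp_eq_add {φ ψ χ : ℝ × ℝ → ℂ} (hφ : IsTestFunction φ) (hψ : IsTestFunction ψ)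
    (hχ : IsTestFunction χ) (h : ∀ p, χ p = φ p + ψ p) :
    hχ.memLp.toLp χ = hφ.memLp.toLp φ + hψ.memLp.toLp ψ := by
  obtain rfl : χ = φ + ψ := funext h
  rfl

lemma toLp_eq_smul (c : ℂ) {φ χ : ℝ × ℝ → ℂ} (hφ : IsTestFunction φ)
    (hχ : IsTestFunction χ) (h : ∀ p, χ p = c * φ p) :
    hχ.memLp.toLp χ = c • hφ.memLp.toLp φ := by
  obtain rfl : χ = c • φ := funext h
  rfl

lemma quad_add {φ ψ : ℝ × ℝ → ℂ} (hφ : IsTestFunction φ) (hψ : IsTestFunction ψ) (α a : ℝ) :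
    (hφ.add hψ).quad α a = hφ.quad α a + hψ.quad α a := by
  have e (v p : ℝ × ℝ) : fderiv ℝ (φ + ψ) p v = fderiv ℝ φ p v + fderiv ℝ ψ p v := by
    rw [fderiv_add (hφ.differentiable p) (hψ.differentiable p)]
    rfl
  refine Prod.ext ?_ (Prod.ext ?_ (Prod.ext ?_ ?_))
  · exact toLp_eq_add hφ hψ (hφ.add hψ) fun p => rfl
  · exact toLp_eq_add (hφ.fderiv_apply (1, 0)) (hψ.fderiv_apply (1, 0))
      ((hφ.add hψ).fderiv_apply (1, 0)) (e (1, 0))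
  · exact toLp_eq_add (hφ.fderiv_apply (0, 1)) (hψ.fderiv_apply (0, 1))
      ((hφ.add hψ).fderiv_apply (0, 1)) (e (0, 1))
  · exact toLp_eq_add (hφ.tilt_mul α a) (hψ.tilt_mul α a)
      ((hφ.add hψ).tilt_mul α a) fun p => mul_add _ _ _

lemma quad_smul (c : ℂ) {φ : ℝ × ℝ → ℂ} (hφ : IsTestFunction φ) (α a : ℝ) :
    (hφ.smul c).quad α a = c • hφ.quad α a := by
  have e (v p : ℝ × ℝ) : fderiv ℝ (c • φ) p v = c * fderiv ℝ φ p v := by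
    rw [fderiv_const_smul (hφ.differentiable p)]
    rfl
  refine Prod.ext ?_ (Prod.ext ?_ (Prod.ext ?_ ?_))
  · exact toLp_eq_smul c hφ (hφ.smul c) fun p => rfl
  · exact toLp_eq_smul c (hφ.fderiv_apply (1, 0)) ((hφ.smul c).fderiv_apply (1, 0)) (e (1, 0))
  · exact toLp_eq_smul c (hφ.fderiv_apply (0, 1)) ((hφ.smul c).fderiv_apply (0, 1)) (e (0, 1))
  · exact toLp_eq_smul c (hφ.tilt_mul α a) ((hφ.smul c).tilt_mul α a) fun p => mul_left_comm _ _ _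

/-- The map from test functions to `coreGraph`. -/
def quadMap (α a : ℝ) : testSpace →ₗ[ℂ] L2Strip × L2Strip × L2Strip × L2Strip where
  toFun φ := IsTestFunction.quad φ.2 α a
  map_add' φ ψ := quad_add φ.2 ψ.2 α a
  map_smul' c φ := quad_smul c φ.2 α a

lemma quadMap_apply (α a : ℝ) {φ : ℝ × ℝ → ℂ} (hφ : IsTestFunction φ) :
    quadMap α a ⟨φ, hφ⟩ = hφ.quad α a := rfl

lemma coreGraph_eq_range (α a : ℝ) : coreGraph α a = (quadMap α a).range := by
  refine le_antisymm ?_ ?_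
  · rintro ⟨F, Fs, Fu, Ft⟩ ⟨φ, hφ, h1, h2, h3, h4⟩
    refine ⟨⟨φ, hφ⟩, ?_⟩
    rw [quadMap_apply]
    refine Prod.ext ?_ (Prod.ext ?_ (Prod.ext ?_ ?_))
    · exact Lp.ext (hφ.memLp.coeFn_toLp.trans h1.symm)
    · exact Lp.ext ((hφ.fderiv_apply (1, 0)).memLp.coeFn_toLp.trans h2.symm)
    · exact Lp.ext ((hφ.fderiv_apply (0, 1)).memLp.coeFn_toLp.trans h3.symm)
    · exact Lp.ext ((hφ.tilt_mul α a).memLp.coeFn_toLp.trans h4.symm)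
  · rintro _ ⟨φ, rfl⟩
    exact IsTestFunction.quad_mem φ.2 α a

/-- The dilation as a linear map on test functions. -/
def dilateMap {κ : ℝ} (hκ : 0 < κ) : testSpace →ₗ[ℂ] testSpace where
  toFun φ := ⟨dilate κ φ, IsTestFunction.dilate hκ φ.2⟩
  map_add' φ ψ := by
    ext p
    simp [dilate, mul_add]
  map_smul' c φ := by
    ext p
    simp [dilate, mul_left_comm]

/-- A bounded relation whose domain is dense is, after taking the closure, defined everywhere. -/
lemma exists_mem_topologicalClosure {X Y : Type*} [NormedAddCommGroup X] [NormedSpace ℂ X]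
    [NormedAddCommGroup Y] [NormedSpace ℂ Y] [CompleteSpace X] [CompleteSpace Y]
    (R : Submodule ℂ (X × Y)) {C : ℝ} (hC : 0 ≤ C) (hR : ∀ x y, (x, y) ∈ R → ‖y‖ ≤ C * ‖x‖)
    {x : X} (hx : x ∈ (R.map (LinearMap.fst ℂ X Y)).topologicalClosure) :
    ∃ y, (x, y) ∈ R.topologicalClosure := by
  have hcl : ∀ p ∈ R.topologicalClosure, ‖p.2‖ ≤ C * ‖p.1‖ := fun p hp =>
    closure_minimal (s := (R : Set (X × Y))) (t := {p | ‖p.2‖ ≤ C * ‖p.1‖})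
      (fun p hp => hR p.1 p.2 hp) (isClosed_le (by fun_prop) (by fun_prop)) hp
  let f : R.topologicalClosure →L[ℂ] X :=
    (ContinuousLinearMap.fst ℂ X Y).comp R.topologicalClosure.subtypeL
  have : CompleteSpace R.topologicalClosure :=
    R.isClosed_topologicalClosure.completeSpace_coe
  -- On the closed relation the first component controls the pair, so the projection to X is bounded
  -- below and has closed range. That range contains the domain of R, hence its closure.
  have hanti : AntilipschitzWith (C + 1).toNNReal f := by
    refine AddMonoidHomClass.antilipschitz_of_bound f fun p => ?_
    rw [Real.coe_toNNReal _ (by positivity), ← Submodule.norm_coe, Prod.norm_def]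
    have h1 := hcl p p.2
    have h2 : 0 ≤ ‖(p : X × Y).1‖ := norm_nonneg _
    refine max_le ?_ ?_
    · change ‖(p : X × Y).1‖ ≤ (C + 1) * ‖(p : X × Y).1‖
      nlinarith
    · change ‖(p : X × Y).2‖ ≤ (C + 1) * ‖(p : X × Y).1‖
      nlinarith
  have hclosed : IsClosed (Set.range f) := hanti.isClosed_range f.uniformContinuous
  have hsub : ((R.map (LinearMap.fst ℂ X Y) : Submodule ℂ X) : Set X) ⊆ Set.range f := by
    rintro _ ⟨p, hp, rfl⟩
    exact ⟨⟨p, R.le_topologicalClosure hp⟩, rfl⟩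
  obtain ⟨p, rfl⟩ := closure_minimal hsub hclosed hx
  exact ⟨(p : X × Y).2, p.2⟩

/-- The space of the quadruples in `formGraph`. -/
abbrev Quad : Type := L2Strip × L2Strip × L2Strip × L2Strip

lemma quadForm_le (B a : ℝ) (G : L2Strip × L2Strip × L2Strip × L2Strip) :
    quadForm B a G ≤ (1 + (a ^ 2)⁻¹ + B ^ 2) * ‖G‖ ^ 2 := by
  have h1 : ‖G.2‖ ≤ ‖G‖ := norm_snd_le G
  have h2 : ‖G.2.2‖ ≤ ‖G‖ := (norm_snd_le G.2).trans h1
  have h3 : ‖G.2.1‖ ≤ ‖G‖ := (norm_fst_le G.2).trans h1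
  have h4 : ‖G.2.2.1‖ ≤ ‖G‖ := (norm_fst_le G.2.2).trans h2
  have h5 : ‖G.2.2.2‖ ≤ ‖G‖ := (norm_snd_le G.2.2).trans h2
  calc quadForm B a G
      ≤ ‖G‖ ^ 2 + (a ^ 2)⁻¹ * ‖G‖ ^ 2 + B ^ 2 * ‖G‖ ^ 2 := by unfold quadForm; gcongr
    _ = _ := by ring

/-- The counterpart of `quadForm_le`: together they make the graph of the dilation a bounded
relation for the product norm, as needed to extend it to the whole form domain. -/
lemma norm_le_of_quadForm_le {B a : ℝ} (hB : B ≠ 0) (ha : a ≠ 0)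
    {F : L2Strip × L2Strip × L2Strip × L2Strip} {r : ℝ} (hr : 0 ≤ r) (h1 : ‖F.1‖ ≤ r)
    (h2 : quadForm B a F ≤ r ^ 2) : ‖F‖ ≤ (1 + |a| + |B|⁻¹) * r := by
  have ha' : 0 < |a| := abs_pos.2 ha
  have hB' : 0 < |B| := abs_pos.2 hB
  have e2 : (a ^ 2)⁻¹ * ‖F.2.2.1‖ ^ 2 = (|a|⁻¹ * ‖F.2.2.1‖) ^ 2 := by
    rw [mul_pow, inv_pow, sq_abs]
  have e3 : B ^ 2 * ‖F.2.2.2‖ ^ 2 = (|B| * ‖F.2.2.2‖) ^ 2 := by rw [mul_pow, sq_abs]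
  rw [quadForm, e2, e3] at h2
  have q1 := sq_nonneg ‖F.2.1‖
  have q2 := sq_nonneg (|a|⁻¹ * ‖F.2.2.1‖)
  have q3 := sq_nonneg (|B| * ‖F.2.2.2‖)
  have k1 : ‖F.2.1‖ ≤ r := le_of_sq_le_sq (by linarith) hr
  have k2 : |a|⁻¹ * ‖F.2.2.1‖ ≤ r := le_of_sq_le_sq (by linarith) hr
  have k3 : |B| * ‖F.2.2.2‖ ≤ r := le_of_sq_le_sq (by linarith) hr
  rw [inv_mul_le_iff₀ ha'] at k2
  rw [← le_inv_mul_iff₀ hB'] at k3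
  have p2 : 0 ≤ |a| * r := by positivity
  have p3 : 0 ≤ |B|⁻¹ * r := by positivity
  simp only [Prod.norm_def]
  refine max_le ?_ (max_le ?_ (max_le ?_ ?_)) <;> nlinarith

/-- The comparison of the eigenvalues, given the compactness of the embeddings. -/
theorem eigenvalue_add_spectralGap_le {αm αp B a ε : ℝ} (hαp : 0 < αp) (hαp1 : αp ≤ 1)
    (hαm : 0 < αm) (hB : 0 < B) (ha : 0 < a) (hε : 0 < ε) (hgp : 0 < g αp ε)
    (hg : g αp ε < g αm (-ε)) (hgap : 0 ≤ spectralGap αm αp B a ε)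
    (hJ : IsCompactOperator (embed αm B a)) (hL : IsCompactOperator (embed αp B a))
    {σ τ : ℕ → ℝ} (hσ : IsEigenvalueEnumeration (modelOperator αm B a) σ)
    (hτ : IsEigenvalueEnumeration (modelOperator αp B a) τ) (m : ℕ) :
    τ m + spectralGap αm αp B a ε ≤ σ m := by
  obtain ⟨κ, hκ, hκ2⟩ : ∃ κ : ℝ, 0 < κ ∧ κ ^ 2 = g αp ε / g αm (-ε) :=
    ⟨√(g αp ε / g αm (-ε)), Real.sqrt_pos.2 (div_pos hgp (hgp.trans hg)),
      Real.sq_sqrt (div_pos hgp (hgp.trans hg)).le⟩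
  set δ := spectralGap αm αp B a ε
  let R₀ : Submodule ℂ (Quad × Quad) :=
    ((quadMap αm a).prod ((quadMap αp a).comp (dilateMap hκ))).range
  have hR₀ : ∀ q ∈ R₀, ‖q.2.1‖ = ‖q.1.1‖ ∧
      quadForm B a q.2 + δ * ‖q.1.1‖ ^ 2 ≤ quadForm B a q.1 := by
    rintro _ ⟨ψ, rfl⟩
    refine ⟨?_, quadForm_dilate_add_le hαp hαp1 hαm hB hε hgp hg hκ hκ2 ψ.2⟩
    rw [← sq_eq_sq₀ (norm_nonneg _) (norm_nonneg _)]
    exact (IsTestFunction.norm_toLp_sq (IsTestFunction.dilate hκ ψ.2)).trans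
      ((IsTestFunction.integral_dilate_sq hκ ψ.2).trans (IsTestFunction.norm_toLp_sq ψ.2).symm)
  -- Membership in the form domains, the equality of norms and the form inequality are closed
  -- conditions, so they pass from test functions to the closure.
  have hcl : ∀ q ∈ R₀.topologicalClosure, q.1 ∈ formGraph αm a ∧ q.2 ∈ formGraph αp a ∧
      ‖q.2.1‖ = ‖q.1.1‖ ∧ quadForm B a q.2 + δ * ‖q.1.1‖ ^ 2 ≤ quadForm B a q.1 := by
    intro q hq
    refine closure_minimal (s := (R₀ : Set (Quad × Quad))) (t := {q | q.1 ∈ formGraph αm a ∧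
      q.2 ∈ formGraph αp a ∧ ‖q.2.1‖ = ‖q.1.1‖ ∧
      quadForm B a q.2 + δ * ‖q.1.1‖ ^ 2 ≤ quadForm B a q.1}) ?_ ?_ hq
    · intro q hq
      refine ⟨?_, ?_, hR₀ q hq⟩
      · obtain ⟨ψ, rfl⟩ := hq
        exact (coreGraph αm a).le_topologicalClosure (IsTestFunction.quad_mem ψ.2 αm a)
      · obtain ⟨ψ, rfl⟩ := hq
        exact (coreGraph αp a).le_topologicalClosure
          (IsTestFunction.quad_mem (dilateMap hκ ψ).2 αp a)
    · have hq := continuous_quadForm B a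
      refine (((coreGraph αm a).isClosed_topologicalClosure).preimage continuous_fst).inter
        ((((coreGraph αp a).isClosed_topologicalClosure).preimage continuous_snd).inter
        (IsClosed.and (isClosed_eq ?_ ?_) (isClosed_le ?_ ?_)))
      · exact continuous_snd.fst.norm
      · exact continuous_fst.fst.norm
      · exact (hq.comp continuous_snd).add (continuous_const.mul (continuous_fst.fst.norm.pow 2))
      · exact hq.comp continuous_fst
  let R : Submodule ℂ (formSpace αm B a × formSpace αp B a) := R₀.topologicalClosure.comap
    (((weightMap B a).toLinearMap.comp (formSpace αm B a).subtype).prodMap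
      ((weightMap B a).toLinearMap.comp (formSpace αp B a).subtype))
  refine eigenvalue_add_le hJ hL (isFormOperator_modelOperator hB.ne' ha.ne' αm)
    (isFormOperator_modelOperator hB.ne' ha.ne' αp) R δ ?_ ?_ ?_ hσ hτ m
  · intro x
    set c : ℝ := 1 + (1 + (a ^ 2)⁻¹ + B ^ 2) with hc
    have hc1 : 1 ≤ c := by
      rw [hc, le_add_iff_nonneg_right]
      positivity
    -- Since δ ≥ 0, the form of F is at most that of G. The summand 1 in c covers ‖F.1‖ = ‖G.1‖, the
    -- rest covers the form.
    have hbound : ∀ G F : Quad, (G, F) ∈ R₀ → ‖F‖ ≤ ((1 + |a| + |B|⁻¹) * √c) * ‖G‖ := by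
      intro G F hGF
      obtain ⟨h1, h2⟩ := hR₀ _ hGF
      rw [mul_assoc]
      refine norm_le_of_quadForm_le hB.ne' ha.ne' (by positivity) ?_ ?_
      · simp only at h1
        rw [h1]
        refine (norm_fst_le G).trans (le_mul_of_one_le_left (norm_nonneg _) ?_)
        exact Real.one_le_sqrt.2 hc1
      · rw [mul_pow, Real.sq_sqrt (by linarith)]
        have h3 := quadForm_le B a G
        have h4 : 0 ≤ δ * ‖G.1‖ ^ 2 := by positivity
        simp only at h2
        nlinarith [sq_nonneg ‖G‖]
    have hx : weightMap B a x ∈ (R₀.map (LinearMap.fst ℂ Quad Quad)).topologicalClosure := by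
      have hmap : R₀.map (LinearMap.fst ℂ Quad Quad) = coreGraph αm a := by
        rw [coreGraph_eq_range, ← LinearMap.range_comp]
        rfl
      rw [hmap]
      exact x.2
    obtain ⟨F, hF⟩ := exists_mem_topologicalClosure R₀ (by positivity) hbound hx
    obtain ⟨y, rfl⟩ := exists_weightMap_eq (B := B) hB.ne' ha.ne' (hcl _ hF).2.1
    exact ⟨y, hF⟩
  · intro x y hxy
    exact (hcl _ hxy).2.2.1
  · intro x y hxy
    have h := hcl _ hxy
    rw [norm_sq_eq_quadForm hB.ne' ha.ne', norm_sq_eq_quadForm hB.ne' ha.ne']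
    have h1 : ‖embed αp B a y‖ = ‖embed αm B a x‖ := h.2.2.1
    have h2 : quadForm B a (weightMap B a y) + δ * ‖embed αm B a x‖ ^ 2 ≤
      quadForm B a (weightMap B a x) := h.2.2.2
    rw [h1]
    linarith

/-! ### The Poincaré inequality -/

section Interval

variable {c h : ℝ}

/-- Expanding the square of f minus its mean gives the variance identity; its nonnegativity is the
Cauchy–Schwarz bound. -/
lemma norm_setIntegral_sq_le {E : Type*} [NormedAddCommGroup E] [InnerProductSpace ℝ E]
    [CompleteSpace E] (hh : 0 < h) {f : ℝ → E} (hf : Continuous f) :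
    ‖∫ x in Set.Ioc c (c + h), f x‖ ^ 2 ≤ h * ∫ x in Set.Ioc c (c + h), ‖f x‖ ^ 2 ∧
    (∫ x in Set.Ioc c (c + h), ‖f x - h⁻¹ • ∫ y in Set.Ioc c (c + h), f y‖ ^ 2) =
      (∫ x in Set.Ioc c (c + h), ‖f x‖ ^ 2) - h⁻¹ * ‖∫ x in Set.Ioc c (c + h), f x‖ ^ 2 := by
  set S := ∫ x in Set.Ioc c (c + h), f x with hS
  have i1 : IntegrableOn (fun x => ‖f x‖ ^ 2) (Set.Ioc c (c + h)) :=
    (hf.norm.pow 2).integrableOn_Ioc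
  have i2 : IntegrableOn (fun x => ⟪h⁻¹ • S, f x⟫_ℝ) (Set.Ioc c (c + h)) :=
    (continuous_const.inner hf).integrableOn_Ioc
  have hvol : (volume : Measure ℝ).real (Set.Ioc c (c + h)) = h := by
    rw [Real.volume_real_Ioc, add_sub_cancel_left, max_eq_left hh.le]
  have key : (∫ x in Set.Ioc c (c + h), ‖f x - h⁻¹ • S‖ ^ 2) =
      (∫ x in Set.Ioc c (c + h), ‖f x‖ ^ 2) - h⁻¹ * ‖S‖ ^ 2 := by
    have e : ∀ x, ‖f x - h⁻¹ • S‖ ^ 2 = ‖f x‖ ^ 2 - 2 * ⟪h⁻¹ • S, f x⟫_ℝ + ‖h⁻¹ • S‖ ^ 2 :=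
      fun x => by rw [norm_sub_sq_real, real_inner_comm]
    simp only [e]
    have i3 : IntegrableOn (fun x => ‖f x‖ ^ 2 - 2 * ⟪h⁻¹ • S, f x⟫_ℝ) (Set.Ioc c (c + h)) :=
      i1.sub (i2.const_mul 2)
    rw [integral_add i3 (by simp),
      integral_sub i1 (i2.const_mul 2), integral_const_mul,
      integral_inner hf.integrableOn_Ioc, setIntegral_const, hvol, ← hS, inner_smul_left,
      real_inner_self_eq_norm_sq, norm_smul, Real.norm_of_nonneg (inv_pos.2 hh).le, smul_eq_mul]
    simp only [conj_trivial]
    field_simp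
    ring
  refine ⟨?_, key⟩
  have h0 : 0 ≤ ∫ x in Set.Ioc c (c + h), ‖f x - h⁻¹ • S‖ ^ 2 :=
    integral_nonneg fun x => sq_nonneg _
  rw [key, sub_nonneg, inv_mul_le_iff₀ hh] at h0
  exact h0

/-- The Poincaré inequality on an interval. -/
theorem poincare_interval (hh : 0 < h) {f f' : ℝ → ℂ} (hf : ∀ x, HasDerivAt f (f' x) x)
    (hf' : Continuous f') :
    ∫ x in Set.Ioc c (c + h), ‖f x‖ ^ 2 ≤ h ^ 2 * (∫ x in Set.Ioc c (c + h), ‖f' x‖ ^ 2) +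
      h⁻¹ * ‖∫ x in Set.Ioc c (c + h), f x‖ ^ 2 := by
  have hfc : Continuous f := continuous_iff_continuousAt.2 fun x => (hf x).continuousAt
  have hvol : (volume : Measure ℝ).real (Set.Ioc c (c + h)) = h := by
    rw [Real.volume_real_Ioc, add_sub_cancel_left, max_eq_left hh.le]
  set M := h * ∫ x in Set.Ioc c (c + h), ‖f' x‖ ^ 2 with hM
  have hM0 : 0 ≤ M := mul_nonneg hh.le (integral_nonneg fun x => sq_nonneg _)
  set S := ∫ x in Set.Ioc c (c + h), f x with hS
  have hL1 : (∫ x in Set.Ioc c (c + h), ‖f' x‖) ≤ √M := by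
    refine Real.le_sqrt_of_sq_le ?_
    have := (norm_setIntegral_sq_le (c := c) hh hf'.norm).1
    simpa using this
  -- The oscillation is at most ∫|f'| ≤ √M, so f also stays within √M of its mean. Integrating the
  -- square over length h yields M·h, whence the factor h².
  have hosc : ∀ x ∈ Set.Ioc c (c + h), ∀ y ∈ Set.Ioc c (c + h), ‖f x - f y‖ ≤ √M := by
    intro x hx y hy
    rw [← intervalIntegral.integral_eq_sub_of_hasDerivAt (fun t _ => hf t)
      (hf'.intervalIntegrable y x)]
    refine (intervalIntegral.norm_integral_le_integral_norm_uIoc).trans (le_trans ?_ hL1)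
    refine setIntegral_mono_set hf'.norm.integrableOn_Ioc
      (Filter.Eventually.of_forall fun t => norm_nonneg _) (LE.le.eventuallyLE ?_)
    exact Set.Ioc_subset_Ioc (le_min hy.1.le hx.1.le) (max_le hy.2 hx.2)
  have hdev : ∀ x ∈ Set.Ioc c (c + h), ‖f x - h⁻¹ • S‖ ^ 2 ≤ M := by
    intro x hx
    have e : f x - h⁻¹ • S = h⁻¹ • ∫ y in Set.Ioc c (c + h), (f x - f y) := by
      rw [integral_sub (by simp) hfc.integrableOn_Ioc, setIntegral_const,
        hvol, smul_sub, smul_smul, inv_mul_cancel₀ hh.ne', one_smul]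
    have h1 : ‖∫ y in Set.Ioc c (c + h), (f x - f y)‖ ≤ √M * h := by
      have := norm_setIntegral_le_of_norm_le_const (μ := volume) (s := Set.Ioc c (c + h))
        (f := fun y => f x - f y) (C := √M) (by simp) fun y hy => hosc x hx y hy
      rwa [hvol] at this
    have h2 : ‖f x - h⁻¹ • S‖ ≤ √M := by
      rw [e, norm_smul, Real.norm_of_nonneg (inv_pos.2 hh).le, inv_mul_le_iff₀ hh, mul_comm]
      exact h1
    calc ‖f x - h⁻¹ • S‖ ^ 2 ≤ √M ^ 2 := by gcongr
      _ = M := Real.sq_sqrt hM0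
  have hint : (∫ x in Set.Ioc c (c + h), ‖f x - h⁻¹ • S‖ ^ 2) ≤ M * h := by
    have h1 : Continuous fun x => ‖f x - h⁻¹ • S‖ ^ 2 := by fun_prop
    calc _ ≤ ∫ x in Set.Ioc c (c + h), M :=
          setIntegral_mono_on h1.integrableOn_Ioc (by simp)
            measurableSet_Ioc hdev
      _ = M * h := by rw [setIntegral_const, hvol, smul_eq_mul, mul_comm]
  rw [(norm_setIntegral_sq_le (c := c) hh hfc).2, ← hS] at hint
  rw [hM] at hint
  linarith

end Interval

lemma hasDerivAt_fst {φ : ℝ × ℝ → ℂ} (hφ : IsTestFunction φ) (s u : ℝ) :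
    HasDerivAt (fun s => φ (s, u)) (dS φ (s, u)) s :=
  (hφ.differentiable (s, u)).hasFDerivAt.comp_hasDerivAt s
    ((hasDerivAt_id s).prodMk (hasDerivAt_const s u))

lemma hasDerivAt_snd {φ : ℝ × ℝ → ℂ} (hφ : IsTestFunction φ) (s u : ℝ) :
    HasDerivAt (fun u => φ (s, u)) (dU φ (s, u)) u :=
  (hφ.differentiable (s, u)).hasFDerivAt.comp_hasDerivAt u
    ((hasDerivAt_const u s).prodMk (hasDerivAt_id u))

/-- Makes the one-dimensional Poincaré inequality applicable, in the variable s, to the integral of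
φ over u. -/
lemma hasDerivAt_setIntegral {φ : ℝ × ℝ → ℂ} (hφ : IsTestFunction φ) (c d s : ℝ) :
    HasDerivAt (fun s => ∫ u in Set.Ioc c d, φ (s, u)) (∫ u in Set.Ioc c d, dS φ (s, u)) s := by
  obtain ⟨C, hC⟩ := hφ.dS.compact.exists_bound_of_continuous hφ.dS.smooth.continuous
  have h1 : ∀ s, Continuous fun u => φ (s, u) := fun s =>
    hφ.smooth.continuous.comp (by fun_prop)
  have h2 : ∀ s, Continuous fun u => dS φ (s, u) := fun s =>
    hφ.dS.smooth.continuous.comp (by fun_prop)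
  exact (hasDerivAt_integral_of_dominated_loc_of_deriv_le (μ := volume.restrict (Set.Ioc c d))
    (F := fun s u => φ (s, u)) (F' := fun s u => dS φ (s, u)) (bound := fun _ => C)
    Filter.univ_mem (Filter.Eventually.of_forall fun s => (h1 s).aestronglyMeasurable)
    (h1 s).integrableOn_Ioc (h2 s).aestronglyMeasurable
    (Filter.Eventually.of_forall fun u s _ => hC (s, u)) (by simp)
    (Filter.Eventually.of_forall fun u s _ => hasDerivAt_fst hφ s u)).2

/-- The Poincaré inequality on a square. -/
theorem poincare_square {φ : ℝ × ℝ → ℂ} (hφ : IsTestFunction φ) {h : ℝ} (hh : 0 < h) (c d : ℝ) :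
    ∫ p in Set.Ioc c (c + h) ×ˢ Set.Ioc d (d + h), ‖φ p‖ ^ 2 ≤
      h ^ 2 * ((∫ p in Set.Ioc c (c + h) ×ˢ Set.Ioc d (d + h), ‖dS φ p‖ ^ 2) +
        ∫ p in Set.Ioc c (c + h) ×ˢ Set.Ioc d (d + h), ‖dU φ p‖ ^ 2) +
      (h ^ 2)⁻¹ * ‖∫ p in Set.Ioc c (c + h) ×ˢ Set.Ioc d (d + h), φ p‖ ^ 2 := by
  set I := Set.Ioc c (c + h)
  set K := Set.Ioc d (d + h)
  have hsq : ∀ {χ : ℝ × ℝ → ℂ}, IsTestFunction χ →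
      ∫ p in I ×ˢ K, ‖χ p‖ ^ 2 = ∫ s in I, ∫ u in K, ‖χ (s, u)‖ ^ 2 := fun hχ =>
    setIntegral_prod _ hχ.integrable_sq.integrableOn
  have hint : ∀ {χ : ℝ × ℝ → ℂ}, IsTestFunction χ →
      IntegrableOn (fun s => ∫ u in K, ‖χ (s, u)‖ ^ 2) I := fun {χ} hχ => by
    have h1 : Integrable (fun p => ‖χ p‖ ^ 2)
        ((volume.restrict I).prod (volume.restrict K)) := by
      rw [Measure.prod_restrict]
      exact hχ.integrable_sq.integrableOn
    exact h1.integral_prod_left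
  have hcont : ∀ {χ : ℝ × ℝ → ℂ}, IsTestFunction χ →
      Continuous (fun s => ∫ u in K, χ (s, u)) := fun hχ =>
    continuous_iff_continuousAt.2 fun s => (hasDerivAt_setIntegral hχ d (d + h) s).continuousAt
  have hslice : ∀ {χ : ℝ × ℝ → ℂ}, IsTestFunction χ → ∀ s, Continuous fun u => χ (s, u) :=
    fun hχ s => hχ.smooth.continuous.comp (by fun_prop)
  have hφI : ∫ p in I ×ˢ K, φ p = ∫ s in I, ∫ u in K, φ (s, u) :=
    setIntegral_prod _ (hφ.smooth.continuous.integrable_of_hasCompactSupport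
      hφ.compact).integrableOn
  have iF : IntegrableOn (fun s => ‖∫ u in K, φ (s, u)‖ ^ 2) I :=
    ((hcont hφ).norm.pow 2).integrableOn_Ioc
  have iF' : IntegrableOn (fun s => ‖∫ u in K, dS φ (s, u)‖ ^ 2) I :=
    ((hcont hφ.dS).norm.pow 2).integrableOn_Ioc
  -- Poincaré in u for each fixed s leaves the integrals over u. Poincaré in s treats these, and
  -- Cauchy–Schwarz bounds the square of the integral of ∂ₛφ over u.
  have step1 : ∫ s in I, ∫ u in K, ‖φ (s, u)‖ ^ 2 ≤
      h ^ 2 * (∫ s in I, ∫ u in K, ‖dU φ (s, u)‖ ^ 2) +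
        h⁻¹ * ∫ s in I, ‖∫ u in K, φ (s, u)‖ ^ 2 := by
    rw [← integral_const_mul, ← integral_const_mul,
      ← integral_add ((hint hφ.dU).const_mul _) (iF.const_mul _)]
    exact integral_mono (hint hφ) (((hint hφ.dU).const_mul _).add (iF.const_mul _)) fun s =>
      poincare_interval hh (fun u => hasDerivAt_snd hφ s u) (hslice hφ.dU s)
  have step2 : ∫ s in I, ‖∫ u in K, φ (s, u)‖ ^ 2 ≤
      h ^ 2 * (∫ s in I, ‖∫ u in K, dS φ (s, u)‖ ^ 2) +
        h⁻¹ * ‖∫ s in I, ∫ u in K, φ (s, u)‖ ^ 2 :=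
    poincare_interval hh (hasDerivAt_setIntegral hφ d (d + h)) (hcont hφ.dS)
  have step3 : ∫ s in I, ‖∫ u in K, dS φ (s, u)‖ ^ 2 ≤
      h * ∫ s in I, ∫ u in K, ‖dS φ (s, u)‖ ^ 2 := by
    rw [← integral_const_mul]
    exact integral_mono iF' ((hint hφ.dS).const_mul _) fun s =>
      (norm_setIntegral_sq_le hh (hslice hφ.dS s)).1
  rw [hsq hφ, hsq hφ.dS, hsq hφ.dU, hφI]
  have step4 := mul_le_mul_of_nonneg_left step2 (inv_pos.2 hh).le
  have step5 := mul_le_mul_of_nonneg_left step3 (show 0 ≤ h⁻¹ * h ^ 2 by positivity)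
  have e1 : h⁻¹ * h ^ 2 * (h * ∫ s in I, ∫ u in K, ‖dS φ (s, u)‖ ^ 2) =
      h ^ 2 * ∫ s in I, ∫ u in K, ‖dS φ (s, u)‖ ^ 2 := by field_simp
  have e2 : h⁻¹ * (h⁻¹ * ‖∫ s in I, ∫ u in K, φ (s, u)‖ ^ 2) =
      (h ^ 2)⁻¹ * ‖∫ s in I, ∫ u in K, φ (s, u)‖ ^ 2 := by field_simp
  rw [e1] at step5
  rw [mul_add, e2] at step4
  linarith

/-! ### Compactness of the embedding -/

/-- The square with the index `i` in the partition of the plane into squares of the side `h`. -/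
def cell (h : ℝ) (i : ℤ × ℤ) : Set (ℝ × ℝ) :=
  Set.Ioc (i.1 * h) (i.1 * h + h) ×ˢ Set.Ioc (i.2 * h) (i.2 * h + h)

lemma measurableSet_cell (h : ℝ) (i : ℤ × ℤ) : MeasurableSet (cell h i) :=
  measurableSet_Ioc.prod measurableSet_Ioc

lemma mem_Ioc_mul_iff {h : ℝ} (hh : 0 < h) {i : ℤ} {x : ℝ} :
    x ∈ Set.Ioc (i * h) (i * h + h) ↔ ⌈x / h⌉ = i + 1 := by
  rw [Int.ceil_eq_iff, Set.mem_Ioc, div_le_iff₀ hh]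
  push_cast
  rw [add_sub_cancel_right, lt_div_iff₀ hh, add_mul, one_mul]

lemma pairwise_disjoint_cell {h : ℝ} (hh : 0 < h) :
    Pairwise (Function.onFun Disjoint (cell h)) := by
  intro i j hij
  refine Set.disjoint_left.2 fun p hp hq => hij ?_
  have h1 := (mem_Ioc_mul_iff hh).1 hp.1
  have h2 := (mem_Ioc_mul_iff hh).1 hq.1
  have h3 := (mem_Ioc_mul_iff hh).1 hp.2
  have h4 := (mem_Ioc_mul_iff hh).1 hq.2
  exact Prod.ext (by omega) (by omega)

lemma sum_setIntegral_cell {h : ℝ} (hh : 0 < h) (t : Finset (ℤ × ℤ)) {f : ℝ × ℝ → ℝ}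
    (hf : Integrable f) :
    ∑ i ∈ t, ∫ p in cell h i, f p = ∫ p in ⋃ i ∈ t, cell h i, f p :=
  (integral_biUnion_finset t (fun i _ => measurableSet_cell h i)
    ((pairwise_disjoint_cell hh).set_pairwise _) fun _ _ => hf.integrableOn).symm

/-- With side 1/n a point has cell indices ⌈ns⌉ - 1 and ⌈nu⌉ - 1, and |s| < N, |u| < 1 force these
into the finite ranges. -/
lemma abs_fst_gt_of_notMem_cells {n N : ℕ} (hn : 0 < n) {p : ℝ × ℝ} (hp : p ∈ strip)
    (hp' : p ∉ ⋃ i ∈ (Finset.Icc (-(N * n : ℤ)) (N * n)) ×ˢ (Finset.Icc (-(n : ℤ)) n),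
      cell (n : ℝ)⁻¹ i) : (N : ℝ) ≤ |p.1| := by
  have hn' : (0 : ℝ) < n := by exact_mod_cast hn
  by_contra! hlt
  apply hp'
  have hu : -1 < p.2 ∧ p.2 < 1 := hp.2
  rw [abs_lt] at hlt
  have bound : ∀ (K : ℕ) (x : ℝ), -K < x → x < K →
      ⌈x / (n : ℝ)⁻¹⌉ - 1 ∈ Finset.Icc (-(K * n : ℤ)) (K * n) := by
    intro K x h1 h2
    rw [div_inv_eq_mul, Finset.mem_Icc]
    have a1 : ⌈x * n⌉ ≤ K * n := by
      rw [Int.ceil_le]; push_cast; nlinarith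
    have a2 : -(K * n : ℤ) < ⌈x * n⌉ := by
      rw [Int.lt_ceil]; push_cast; nlinarith
    constructor <;> omega
  refine Set.mem_iUnion₂.2 ⟨(⌈p.1 / (n : ℝ)⁻¹⌉ - 1, ⌈p.2 / (n : ℝ)⁻¹⌉ - 1), ?_, ?_⟩
  · rw [Finset.mem_product]
    refine ⟨bound N p.1 hlt.1 hlt.2, ?_⟩
    have := bound 1 p.2 (by simpa using hu.1) (by simpa using hu.2)
    simpa using this
  · exact ⟨(mem_Ioc_mul_iff (by positivity)).2 (by simp),
      (mem_Ioc_mul_iff (by positivity)).2 (by simp)⟩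

/-- The u-term is at most a in modulus, so |tilt| ≥ αR - a ≥ αR/2: the potential confines the
particle along the strip. -/
lemma le_tilt_sq_of_le_abs {α a R : ℝ} (hα : 0 < α) (ha : 0 ≤ a) (hR : 0 ≤ R) (hR2 : 2 * a ≤ α * R)
    {p : ℝ × ℝ} (hp : p ∈ strip) (hp1 : R ≤ |p.1|) : (α * R / 2) ^ 2 ≤ tilt α a p ^ 2 := by
  have hu : |p.2| ≤ 1 := (abs_lt.2 hp.2).le
  have hb1 : √(1 - α ^ 2) ≤ 1 := Real.sqrt_le_one.2 (by nlinarith)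
  have h1 : |a * √(1 - α ^ 2) * p.2| ≤ a := by
    rw [abs_mul, abs_of_nonneg (mul_nonneg ha (Real.sqrt_nonneg _)), mul_assoc]
    exact mul_le_of_le_one_right ha (mul_le_one₀ hb1 (abs_nonneg _) hu)
  have h2 : α * R ≤ |α * p.1| := by rw [abs_mul, abs_of_pos hα]; gcongr
  have h3 := abs_sub_abs_le_abs_sub (α * p.1) (a * √(1 - α ^ 2) * p.2)
  rw [← sq_abs (tilt α a p)]
  have h4 : α * R / 2 ≤ |tilt α a p| := by
    change _ ≤ |α * p.1 - a * √(1 - α ^ 2) * p.2|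
    linarith
  gcongr

/-- Up to finitely many mean values, the `L²` norm of a test function is small compared with its
form norm. -/
theorem exists_norm_sq_le_add_sum_cell {α a η : ℝ} (hα : 0 < α) (ha : 0 ≤ a) (hη : 0 < η) :
    ∃ (t : Finset (ℤ × ℤ)) (h C : ℝ), ∀ φ : ℝ × ℝ → ℂ, IsTestFunction φ →
      ∫ p, ‖φ p‖ ^ 2 ≤ η * ((∫ p, ‖dS φ p‖ ^ 2) + (∫ p, ‖dU φ p‖ ^ 2) +
        ∫ p, tilt α a p ^ 2 * ‖φ p‖ ^ 2) + C * ∑ i ∈ t, ‖∫ p in cell h i, φ p‖ ^ 2 := by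
  -- The side 1/n is at most both η and 1, so its square, the Poincaré constant, is at most η.
  obtain ⟨n, hn⟩ := exists_nat_gt (max 1 η⁻¹)
  have hn1 : (1 : ℝ) < n := (le_max_left _ _).trans_lt hn
  have hn2 : η⁻¹ < n := (le_max_right _ _).trans_lt hn
  have hn0 : (0 : ℝ) < n := by linarith
  have hh2 : ((n : ℝ)⁻¹) ^ 2 ≤ η := by
    have h1 : (n : ℝ)⁻¹ ≤ η := by
      rw [inv_le_comm₀ hn0 hη]; exact hn2.le
    have h2 : (n : ℝ)⁻¹ ≤ 1 := inv_le_one_of_one_le₀ hn1.le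
    have h3 : 0 < (n : ℝ)⁻¹ := by positivity
    nlinarith
  -- N is so large that η·tilt² ≥ 1 on the part of the strip with |s| ≥ N; there the potential term
  -- alone dominates.
  obtain ⟨N, hN⟩ := exists_nat_gt (max (2 * a / α) (2 / (α * √η)))
  have hN1 : 2 * a ≤ α * N := by
    have := (le_max_left _ _).trans_lt hN
    rw [div_lt_iff₀ hα] at this
    linarith
  have hN2 : 1 ≤ η * (α * N / 2) ^ 2 := by
    have h1 := (le_max_right _ _).trans_lt hN
    have hs : 0 < √η := Real.sqrt_pos.2 hη
    rw [div_lt_iff₀ (by positivity)] at h1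
    have h2 : 1 ≤ √η * (α * N / 2) := by nlinarith
    have h3 : η * (α * N / 2) ^ 2 = (√η * (α * N / 2)) ^ 2 := by
      rw [mul_pow, Real.sq_sqrt hη.le]
    rw [h3]
    exact one_le_pow₀ h2
  set t := (Finset.Icc (-(N * n : ℤ)) (N * n)) ×ˢ (Finset.Icc (-(n : ℤ)) n) with ht
  set h : ℝ := (n : ℝ)⁻¹ with hh
  have hh0 : 0 < h := by positivity
  refine ⟨t, h, (h ^ 2)⁻¹, fun φ hφ => ?_⟩
  set U := ⋃ i ∈ t, cell h i with hU
  have hUm : MeasurableSet U :=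
    Finset.measurableSet_biUnion t fun i _ => measurableSet_cell h i
  have hloc : ∀ {χ : ℝ × ℝ → ℂ}, IsTestFunction χ →
      ∑ i ∈ t, ∫ p in cell h i, ‖χ p‖ ^ 2 ≤ ∫ p, ‖χ p‖ ^ 2 := fun hχ => by
    rw [sum_setIntegral_cell hh0 t hχ.integrable_sq]
    exact setIntegral_le_integral hχ.integrable_sq
      (Filter.Eventually.of_forall fun p => sq_nonneg _)
  have hin : ∫ p in U, ‖φ p‖ ^ 2 ≤ η * ((∫ p, ‖dS φ p‖ ^ 2) + ∫ p, ‖dU φ p‖ ^ 2) +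
      (h ^ 2)⁻¹ * ∑ i ∈ t, ‖∫ p in cell h i, φ p‖ ^ 2 := by
    rw [hU, ← sum_setIntegral_cell hh0 t hφ.integrable_sq]
    have h1 := Finset.sum_le_sum fun i (_ : i ∈ t) =>
      poincare_square hφ hh0 (i.1 * h) (i.2 * h)
    rw [Finset.sum_add_distrib, ← Finset.mul_sum, ← Finset.mul_sum, Finset.sum_add_distrib] at h1
    have h2 := add_le_add (hloc hφ.dS) (hloc hφ.dU)
    have h3 : 0 ≤ (∫ p, ‖dS φ p‖ ^ 2) + ∫ p, ‖dU φ p‖ ^ 2 :=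
      add_nonneg (integral_nonneg fun _ => sq_nonneg _) (integral_nonneg fun _ => sq_nonneg _)
    refine h1.trans (add_le_add_left ?_ _)
    exact (mul_le_mul_of_nonneg_left h2 (sq_nonneg h)).trans (mul_le_mul_of_nonneg_right hh2 h3)
  have hout : ∫ p in Uᶜ, ‖φ p‖ ^ 2 ≤ η * ∫ p, tilt α a p ^ 2 * ‖φ p‖ ^ 2 := by
    have i1 := (hφ.integrable_tilt_sq α a).const_mul η
    have h1 : ∫ p in Uᶜ, ‖φ p‖ ^ 2 ≤ ∫ p in Uᶜ, η * (tilt α a p ^ 2 * ‖φ p‖ ^ 2) := by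
      refine setIntegral_mono_on hφ.integrable_sq.integrableOn i1.integrableOn hUm.compl
        fun p hp => ?_
      by_cases hps : p ∈ strip
      · have h2 := abs_fst_gt_of_notMem_cells (N := N) (by exact_mod_cast hn0) hps hp
        have h3 := le_tilt_sq_of_le_abs hα ha (Nat.cast_nonneg N) hN1 hps h2
        have h4 : 1 ≤ η * tilt α a p ^ 2 :=
          hN2.trans (mul_le_mul_of_nonneg_left h3 hη.le)
        rw [← mul_assoc]
        exact le_mul_of_one_le_left (sq_nonneg _) h4
      · simp [hφ.eq_zero hps]
    rw [← integral_const_mul]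
    refine h1.trans (setIntegral_le_integral i1 (Filter.Eventually.of_forall fun p => ?_))
    exact mul_nonneg hη.le (mul_nonneg (sq_nonneg _) (sq_nonneg _))
  rw [← integral_add_compl hUm hφ.integrable_sq]
  linarith

/-- The mean values over cells are pairings with indicator functions, so the estimate for test
functions is continuous in the quadruple and extends to the form domain. It is then the hypothesis
of the compactness criterion. -/
theorem isCompactOperator_embed {α B a : ℝ} (hα : 0 < α) (hB : 0 < B) (ha : 0 < a) :
    IsCompactOperator (embed α B a) := by
  refine isCompactOperator_of_forall_norm_sq_le _ fun η hη => ?_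
  -- K absorbs the weights: the unweighted sum of squares is at most K times the squared form norm.
  set K : ℝ := 1 + a ^ 2 + (B ^ 2)⁻¹ with hK
  have hK0 : 0 < K := by positivity
  obtain ⟨t, h, C, hC⟩ := exists_norm_sq_le_add_sum_cell hα ha.le (div_pos hη hK0)
  have hfin : ∀ i, (volume.restrict strip) (cell h i) ≠ ⊤ := fun i =>
    ne_top_of_le_ne_top (by
      rw [cell, Measure.volume_eq_prod, Measure.prod_prod]
      simp [ENNReal.mul_eq_top]) (Measure.restrict_apply_le _ _)
  let f (i : ℤ × ℤ) : L2Strip := indicatorConstLp 2 (measurableSet_cell h i) (hfin i) (1 : ℂ)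
  have hf : ∀ {φ : ℝ × ℝ → ℂ} (hφ : IsTestFunction φ) i,
      ⟪f i, hφ.memLp.toLp φ⟫_ℂ = ∫ p in cell h i, φ p := fun {φ} hφ i => by
    rw [L2.inner_indicatorConstLp_one, setIntegral_congr_ae₀ (g := φ)
      (measurableSet_cell h i).nullMeasurableSet
      (hφ.memLp.coeFn_toLp.mono fun p hp _ => hp),
      Measure.restrict_restrict (measurableSet_cell h i)]
    refine setIntegral_eq_of_subset_of_forall_sdiff_eq_zero (measurableSet_cell h i)
      Set.inter_subset_left (fun p hp => ?_) |>.symm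
    exact hφ.eq_zero fun hs => hp.2 ⟨hp.1, hs⟩
  have hcl : ∀ G ∈ formGraph α a, ‖G.1‖ ^ 2 ≤
      η / K * (‖G.2.1‖ ^ 2 + ‖G.2.2.1‖ ^ 2 + ‖G.2.2.2‖ ^ 2) + C * ∑ i ∈ t, ‖⟪f i, G.1⟫_ℂ‖ ^ 2 := by
    intro G hG
    refine closure_minimal (s := (coreGraph α a : Set (L2Strip × L2Strip × L2Strip × L2Strip)))
      (t := {G | ‖G.1‖ ^ 2 ≤ η / K * (‖G.2.1‖ ^ 2 + ‖G.2.2.1‖ ^ 2 + ‖G.2.2.2‖ ^ 2) +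
        C * ∑ i ∈ t, ‖⟪f i, G.1⟫_ℂ‖ ^ 2}) ?_ (isClosed_le (by fun_prop) (by fun_prop)) hG
    intro G hG
    rw [SetLike.mem_coe, coreGraph_eq_range] at hG
    obtain ⟨⟨φ, hφ' : IsTestFunction φ⟩, rfl⟩ := hG
    have hφ : IsTestFunction φ := hφ'
    have h1 := hC φ hφ
    have h2 := (hφ.tilt_mul α a).norm_toLp_sq
    simp only [norm_mul, mul_pow, Complex.norm_real, Real.norm_eq_abs, sq_abs] at h2
    simp only [← hf hφ] at h1
    rw [← h2, ← hφ.norm_toLp_sq, ← hφ.dS.norm_toLp_sq, ← hφ.dU.norm_toLp_sq] at h1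
    exact h1
  let e := t.equivFin
  refine ⟨t.card, fun k => f (e.symm k), C, fun x => ?_⟩
  have h1 := hcl _ x.2
  have h2 : ∑ k, ‖⟪f (e.symm k), embed α B a x⟫_ℂ‖ ^ 2 =
      ∑ i ∈ t, ‖⟪f i, embed α B a x⟫_ℂ‖ ^ 2 := by
    rw [← Finset.sum_coe_sort t]
    exact e.symm.sum_comp fun i => ‖⟪f i, embed α B a x⟫_ℂ‖ ^ 2
  rw [h2]
  refine h1.trans (add_le_add_left ?_ _)
  rw [div_mul_eq_mul_div, div_le_iff₀ hK0, mul_assoc]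
  refine mul_le_mul_of_nonneg_left ?_ hη.le
  rw [norm_sq_eq_quadForm hB.ne' ha.ne']
  set G := weightMap B a x
  have q1 : ‖G.2.2.1‖ ^ 2 = a ^ 2 * ((a ^ 2)⁻¹ * ‖G.2.2.1‖ ^ 2) := by field_simp
  have q2 : ‖G.2.2.2‖ ^ 2 = (B ^ 2)⁻¹ * (B ^ 2 * ‖G.2.2.2‖ ^ 2) := by field_simp
  change ‖G.2.1‖ ^ 2 + ‖G.2.2.1‖ ^ 2 + ‖G.2.2.2‖ ^ 2 ≤ _
  rw [q1, q2, quadForm]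
  have p0 := sq_nonneg ‖embed α B a x‖
  have p1 := sq_nonneg ‖G.2.1‖
  have p2 : 0 ≤ (a ^ 2)⁻¹ * ‖G.2.2.1‖ ^ 2 := by positivity
  have p3 : 0 ≤ B ^ 2 * ‖G.2.2.2‖ ^ 2 := by positivity
  have p4 : 0 ≤ a ^ 2 := sq_nonneg a
  have p5 : 0 ≤ (B ^ 2)⁻¹ := by positivity
  rw [hK]
  generalize ‖G.2.1‖ ^ 2 = y1 at *
  generalize (a ^ 2)⁻¹ * ‖G.2.2.1‖ ^ 2 = y2 at *
  generalize B ^ 2 * ‖G.2.2.2‖ ^ 2 = y3 at *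
  generalize a ^ 2 = y4 at *
  generalize (B ^ 2)⁻¹ = y5 at *
  generalize ‖embed α B a x‖ ^ 2 = y6 at *
  have : (y6 + (y1 + y2 + y3)) * (1 + y4 + y5) = y1 + y4 * y2 + y5 * y3 +
    (y6 * (1 + y4 + y5) + y2 + y3 + y1 * y4 + y1 * y5 + y2 * y5 + y3 * y4) := by ring
  have : 0 ≤ y6 * (1 + y4 + y5) + y2 + y3 + y1 * y4 + y1 * y5 + y2 * y5 + y3 * y4 := by positivity
  linarith

/-! ### The form domain is infinite-dimensional -/

lemma exists_isTestFunction_tsupport_subset (k : ℕ) :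
    ∃ φ : ℝ × ℝ → ℂ, IsTestFunction φ ∧ φ (3 * k, 0) = 1 ∧
      Function.support φ ⊆ Metric.ball (3 * (k : ℝ), (0 : ℝ)) (1 / 2) := by
  let b : ContDiffBump ((3 * (k : ℝ), (0 : ℝ)) : ℝ × ℝ) := ⟨1 / 4, 1 / 2, by norm_num, by norm_num⟩
  refine ⟨fun p => (b p : ℂ), ⟨Complex.ofRealCLM.contDiff.comp b.contDiff,
    b.hasCompactSupport.comp_left (g := Complex.ofReal) rfl, ?_⟩, ?_, ?_⟩
  · refine (closure_mono (Function.support_comp_subset (g := Complex.ofReal) rfl b)).trans ?_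
    change tsupport b ⊆ strip
    rw [b.tsupport_eq]
    intro p hp
    rw [Metric.mem_closedBall, Prod.dist_eq, max_le_iff] at hp
    have h2 : |p.2 - 0| ≤ 1 / 2 := hp.2
    rw [sub_zero, abs_le] at h2
    exact ⟨trivial, by linarith, by linarith⟩
  · have : b (3 * (k : ℝ), (0 : ℝ)) = 1 := b.one_of_mem_closedBall (by simp [b.rIn_pos.le])
    simp [this]
  · refine (Function.support_comp_subset (g := Complex.ofReal) rfl b).trans ?_
    rw [b.support_eq]

/-- Bumps of radius 1/2 around the points (3k, 0) have disjoint supports, so they are nonzero and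
mutually orthogonal. -/
theorem not_finiteDimensional_range_embed {α B a : ℝ} (hB : B ≠ 0) (ha : a ≠ 0) :
    ¬ FiniteDimensional ℂ (embed α B a).toLinearMap.range := by
  intro hfin
  choose φ hφ h1 hsupp using exists_isTestFunction_tsupport_subset
  let v : ℕ → L2Strip := fun k => (hφ k).memLp.toLp (φ k)
  have hv : ∀ k, v k ∈ (embed α B a).toLinearMap.range := fun k => by
    obtain ⟨x, hx⟩ := exists_weightMap_eq hB ha
      ((coreGraph α a).le_topologicalClosure ((hφ k).quad_mem α a))
    exact ⟨x, congrArg Prod.fst hx⟩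
  have hv0 : ∀ k, v k ≠ 0 := fun k h0 => by
    have h2 := (hφ k).norm_toLp_sq
    have h3 : ‖(hφ k).memLp.toLp (φ k)‖ = 0 := norm_eq_zero.2 h0
    rw [h3] at h2
    have hc : Continuous fun p => ‖φ k p‖ ^ 2 := by
      have := (hφ k).smooth.continuous
      fun_prop
    have h4 : 0 < ∫ p, ‖φ k p‖ ^ 2 :=
      integral_pos_of_integrable_nonneg_nonzero hc (hφ k).integrable_sq
        (fun p => sq_nonneg _) (x := (3 * k, 0)) (by simp [h1])
    rw [← h2] at h4
    norm_num at h4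
  have horth : Pairwise fun j k => ⟪v j, v k⟫_ℂ = 0 := fun j k hjk => by
    change ⟪v j, v k⟫_ℂ = 0
    rw [inner_toLp (hφ j) (hφ k).memLp.coeFn_toLp (hφ k)]
    refine integral_eq_zero_of_ae (Filter.Eventually.of_forall fun p => ?_)
    by_contra hne
    have hj : φ j p ≠ 0 := fun h => hne (by simp [h])
    have hk : φ k p ≠ 0 := fun h => hne (by simp [h])
    have d1 := Metric.mem_ball.1 (hsupp j hj)
    have d2 := Metric.mem_ball.1 (hsupp k hk)
    rw [Prod.dist_eq, max_lt_iff] at d1 d2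
    have e1 : |p.1 - 3 * j| < 1 / 2 := d1.1
    have e2 : |p.1 - 3 * k| < 1 / 2 := d2.1
    rw [abs_lt] at e1 e2
    apply hjk
    rcases lt_trichotomy j k with h | h | h
    · have : (j : ℝ) + 1 ≤ k := by exact_mod_cast h
      linarith
    · exact h
    · have : (k : ℝ) + 1 ≤ j := by exact_mod_cast h
      linarith
  have hli : LinearIndependent ℂ v := linearIndependent_of_ne_zero_of_inner_eq_zero hv0 horth
  have hli' : LinearIndependent ℂ fun k =>
      (⟨v k, hv k⟩ : (embed α B a).toLinearMap.range) :=
    LinearIndependent.of_comp (embed α B a).toLinearMap.range.subtype hli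
  have := hli'.finite
  exact not_finite ℕ

/-! ### The main result -/

theorem exists_isEigenvalueEnumeration {α B a : ℝ} (hα : 0 < α) (hB : 0 < B) (ha : 0 < a) :
    ∃ σ : ℕ → ℝ, IsEigenvalueEnumeration (modelOperator α B a) σ :=
  (isFormOperator_modelOperator hB.ne' ha.ne' α).exists_enumeration
    (isCompactOperator_embed hα hB ha) (not_finiteDimensional_range_embed hB.ne' ha.ne')

/-- Only the first summand is surely positive, because α₊ < 1; the second vanishes when α₋ = 1. -/
lemma eps0_denominator_pos {αm αp : ℝ} (hαp : 0 < αp) (hα : αp < αm) (hαm : αm ≤ 1) :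
    0 < αp * √(1 - αp ^ 2) + αm * √(1 - αm ^ 2) := by
  have h1 : 0 < √(1 - αp ^ 2) := Real.sqrt_pos.2 (by nlinarith)
  have h2 : 0 ≤ √(1 - αm ^ 2) := Real.sqrt_nonneg _
  have := hαp.trans hα
  positivity

/-- Cleared of its denominator, ε < ε₀ is precisely the strict inequality between the two radicands.
-/
lemma g_lt_g {αm αp ε : ℝ} (hαp : 0 < αp) (hα : αp < αm) (hαm : αm ≤ 1) (hε : 0 < ε)
    (hε0 : ε < eps0 αm αp) : g αp ε < g αm (-ε) := by
  rw [eps0, lt_div_iff₀ (eps0_denominator_pos hαp hα hαm)] at hε0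
  refine Real.sqrt_lt_sqrt (by positivity) ?_
  linarith

lemma g_pos {α ε : ℝ} (hα : 0 < α) (hε : 0 < ε) : 0 < g α ε :=
  Real.sqrt_pos.2 (by positivity)

/-- With X the difference of the g's and Y the denominator in a₀, squaring a < a₀ gives a²BY < X,
while the gap equals B(X - a²BY). -/
lemma spectralGap_pos {αm αp B a ε : ℝ} (hαp : 0 < αp) (hα : αp < αm) (hαm : αm ≤ 1)
    (hB : 0 < B) (ha : 0 < a) (hε : 0 < ε) (hε0 : ε < eps0 αm αp) (haε : a < a0 αm αp B ε) :
    0 < spectralGap αm αp B a ε := by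
  have hg := g_lt_g hαp hα hαm hε hε0
  have hD := eps0_denominator_pos hαp hα hαm
  have hY : 0 < 1 - αp ^ 2 + ε⁻¹ * (αp * √(1 - αp ^ 2) + αm * √(1 - αm ^ 2)) := by
    have h1 : 0 < 1 - αp ^ 2 := by nlinarith
    positivity
  rw [a0] at haε
  rw [spectralGap]
  set X := g αm (-ε) - g αp ε
  set Y := 1 - αp ^ 2 + ε⁻¹ * (αp * √(1 - αp ^ 2) + αm * √(1 - αm ^ 2))
  have hX : 0 < X := sub_pos.2 hg
  have h2 : a ^ 2 < (1 / √B * √(X / Y)) ^ 2 := by gcongr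
  rw [mul_pow, div_pow, one_pow, Real.sq_sqrt hB.le, Real.sq_sqrt (div_pos hX hY).le,
    div_mul_div_comm, one_mul, lt_div_iff₀ (mul_pos hB hY)] at h2
  nlinarith

end BentLayer

end

theorem mainTheorem5 (αm αp B a : ℝ) (hαp : 0 < αp) (hα : αp < αm) (hαm : αm ≤ 1)
    (hB : 0 < B) (ha : 0 < a) :
    (∀ ε : ℝ, 0 < ε → ε < BentLayer.eps0 αm αp → BentLayer.g αp ε < BentLayer.g αm (-ε)) ∧
    (∃ σ : ℕ → ℝ, BentLayer.IsEigenvalueEnumeration (BentLayer.modelOperator αp B a) σ) ∧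
    (∃ σ : ℕ → ℝ, BentLayer.IsEigenvalueEnumeration (BentLayer.modelOperator αm B a) σ) ∧
    ((∃ ε : ℝ, 0 < ε ∧ ε < BentLayer.eps0 αm αp ∧ a < BentLayer.a0 αm αp B ε) →
      ∀ σp σm : ℕ → ℝ,
        BentLayer.IsEigenvalueEnumeration (BentLayer.modelOperator αp B a) σp →
        BentLayer.IsEigenvalueEnumeration (BentLayer.modelOperator αm B a) σm →
        ∀ m : ℕ, σp m < σm m) := by
  have hαm0 : 0 < αm := hαp.trans hα
  refine ⟨fun ε hε hε0 => BentLayer.g_lt_g hαp hα hαm hε hε0,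
    BentLayer.exists_isEigenvalueEnumeration hαp hB ha,
    BentLayer.exists_isEigenvalueEnumeration hαm0 hB ha, ?_⟩
  rintro ⟨ε, hε, hε0, haε⟩ σp σm hσp hσm m
  have hgap := BentLayer.spectralGap_pos hαp hα hαm hB ha hε hε0 haε
  have hle := BentLayer.eigenvalue_add_spectralGap_le hαp (hα.le.trans hαm) hαm0 hB ha hε
    (BentLayer.g_pos hαp hε) (BentLayer.g_lt_g hαp hα hαm hε hε0) hgap.le
    (BentLayer.isCompactOperator_embed hαm0 hB ha)
    (BentLayer.isCompactOperator_embed hαp hB ha) hσm hσp m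
  linarith
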